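/- Let $n,k\ge 0$, let $X=\{x_1,\dots,x_n\}$ and $Y=\{y_1,\dots,y_k\}$, and let $F_{n,k}$ be the free group on the disjoint union $X\cup Y$ and $F_n$ the free group on $X$. Let $\mathcal{A}_{n,k}\le\operatorname{Aut}(F_{n,k})$ be the subgroup of all automorphisms $f$ such that $f(y_j)$ is conjugate to $y_j$ for $1\le j\le k$. The homomorphism $F_{n,k}\to F_n$ that fixes each $x_i$ and kills each $y_j$ induces a homomorphism $\pi\colon\mathcal{A}_{n,k}\to\operatorname{Aut}(F_n)$; let $\mathcal{K}_{n,k}=\ker\pi$. Let $IA_{n,k}$ be the group of automorphisms of $F_{n,k}$ that act trivially on its abelianization $\mathbb{Z}^{n+k}$, and let $\mathcal{K}IA_{n,k}=\mathcal{K}_{n,k}\cap IA_{n,k}$. For distinct $z,z'\in X\cup Y$, let $C_{z,z'}\in\operatorname{Aut}(F_{n,k})$ send $z$ to $z'z(z')^{-1}$ and fix all other elements of $X\cup Y$. For $z\in X\cup Y$ and $v$ in the subgroup generated by $(X\cup Y)\setminus\{z\}$, let $M_{z,v}\in\operatorname{Aut}(F_{n,k})$ send $z$ to $vz$ and fix all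 other elements of $X\cup Y$. Write $[a,b]=aba^{-1}b^{-1}$. Then the group $\mathcal{K}IA_{n,k}$ is generated by the finite set \[ \{M_{x,[y,z]} : x\in X,\ y\in Y,\ z\in (X\cup Y)\setminus\{x,y\}\}\ \cup\ \{C_{y,z},\,C_{z,y} : y\in Y,\ z\in (X\cup Y)\setminus\{y\}\}. \] -/

import Mathlib

namespace TorelliBirman

/-- The free group `F_{n,k}` on `{x_1, …, x_n, y_1, …, y_k}`: the basis `X ∪ Y` is indexed by
the disjoint union `Fin n ⊕ Fin k`. -/
abbrev F (n k : ℕ) : Type := FreeGroup (Fin n ⊕ Fin k)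

/-- The basis element `x_i`. -/
def x {n k : ℕ} (i : Fin n) : F n k := FreeGroup.of (Sum.inl i)

/-- The basis element `y_j`. -/
def y {n k : ℕ} (j : Fin k) : F n k := FreeGroup.of (Sum.inr j)

/-- The group of all automorphisms `f` of `F_{n,k}` such that `f (y_j)` is conjugate to `y_j`
for every `j`. -/
def autFB (n k : ℕ) : Subgroup (MulAut (F n k)) where
  carrier := {f | ∀ j : Fin k, IsConj (f (y j)) (y j)}
  one_mem' := fun j => IsConj.refl _
  mul_mem' := by
    intro f g hf hg j
    exact (f.toMonoidHom.map_isConj (hg j)).trans (hf j)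
  inv_mem' := by
    intro f hf j
    have h := (f⁻¹ : MulAut (F n k)).toMonoidHom.map_isConj (hf j)
    have e : (f⁻¹ : MulAut (F n k)).toMonoidHom (f (y j)) = y j := MulAut.inv_apply_self _ f (y j)
    rw [e] at h
    exact h.symm

/-- The projection `F_{n,k} → F_n` with `x_i ↦ x_i` and `y_j ↦ 1`; its kernel is the normal
closure of the `y_j`. -/
def proj (n k : ℕ) : F n k →* FreeGroup (Fin n) :=
  FreeGroup.lift (Sum.elim (fun i => FreeGroup.of i) (fun _ => 1))

/-- The inclusion `F_n → F_{n,k}`, `x_i ↦ x_i`. -/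
def incl (n k : ℕ) : FreeGroup (Fin n) →* F n k :=
  FreeGroup.lift (fun i => x i)

theorem proj_incl {n k : ℕ} (w : FreeGroup (Fin n)) : proj n k (incl n k w) = w := by
  have h : (proj n k).comp (incl n k) = MonoidHom.id _ := by
    ext i
    simp [proj, incl, x]
  exact DFunLike.congr_fun h w

theorem proj_apply_incl_proj {n k : ℕ} (f : autFB n k) (w : F n k) :
    proj n k (f.1 (incl n k (proj n k w))) = proj n k (f.1 w) := by
  have h : (((proj n k).comp f.1.toMonoidHom).comp (incl n k)).comp (proj n k) =
      (proj n k).comp f.1.toMonoidHom := by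
    ext s
    rcases s with i | j
    · simp [proj, incl, x]
    · have h1 := (proj n k).map_isConj (f.2 j)
      have h2 : proj n k (y j) = 1 := by simp [proj, y]
      rw [h2, isConj_one_left] at h1
      have h3 : proj n k (f.1 (FreeGroup.of (Sum.inr j))) = 1 := h1
      have h4 : proj n k (FreeGroup.of (Sum.inr j)) = 1 := h2
      simp [h3, h4]
  exact DFunLike.congr_fun h w

/-- The automorphism of `F_n` induced by an element of `autFB n k`. -/
def induced {n k : ℕ} (f : autFB n k) : MulAut (FreeGroup (Fin n)) where
  toFun w := proj n k (f.1 (incl n k w))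
  invFun w := proj n k ((f⁻¹).1 (incl n k w))
  left_inv w := by
    dsimp only
    rw [proj_apply_incl_proj (f⁻¹)]
    simp [proj_incl]
  right_inv w := by
    dsimp only
    rw [proj_apply_incl_proj f]
    simp [proj_incl]
  map_mul' v w := by simp

/-- The homomorphism `π : autFB n k → Aut(F_n)` induced by the projection `F_{n,k} → F_n`. -/
def birmanMap (n k : ℕ) : autFB n k →* MulAut (FreeGroup (Fin n)) where
  toFun := induced
  map_one' := by
    ext1 w
    exact proj_incl w
  map_mul' f g := by
    ext1 w
    exact (proj_apply_incl_proj f (g.1 (incl n k w))).symm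

/-- The defining property of `π`: the projection intertwines `f` and `π f`. -/
theorem birmanMap_proj {n k : ℕ} (f : autFB n k) (w : F n k) :
    birmanMap n k f (proj n k w) = proj n k (f.1 w) :=
  proj_apply_incl_proj f w

/-- The Birman kernel `𝒦_{n,k} = ker π`, as a subgroup of `Aut(F_{n,k})`. -/
def birmanKernel (n k : ℕ) : Subgroup (MulAut (F n k)) :=
  (birmanMap n k).ker.map (autFB n k).subtype

/-- The action of the automorphism group of a group on the abelianization of the group. -/
def abAction (G : Type*) [Group G] : MulAut G →* MulAut (Abelianization G) where
  toFun f := MulEquiv.abelianizationCongr f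
  map_one' := by
    ext a
    induction a using QuotientGroup.induction_on with
    | H g => rfl
  map_mul' f g := by
    ext a
    induction a using QuotientGroup.induction_on with
    | H g => rfl

/-- The Torelli subgroup `IA_{n,k}`: the automorphisms of `F_{n,k}` that act trivially on its
abelianization. -/
def torelli (n k : ℕ) : Subgroup (MulAut (F n k)) := (abAction (F n k)).ker

/-- The Torelli Birman kernel `𝒦IA_{n,k} = 𝒦_{n,k} ∩ IA_{n,k}`. -/
def torelliBirmanKernel (n k : ℕ) : Subgroup (MulAut (F n k)) :=
  birmanKernel n k ⊓ torelli n k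

theorem of_mem_closure {S : Type*} {z s : S} (h : s ≠ z) :
    FreeGroup.of s ∈ Subgroup.closure (FreeGroup.of '' {s : S | s ≠ z}) :=
  Subgroup.subset_closure ⟨s, h, rfl⟩

section Generators

open scoped commutatorElement

variable {S : Type*} [DecidableEq S]

/-- The endomorphism with `z ↦ u z u'`, fixing all other basis elements. -/
def twoSided (z : S) (u u' : FreeGroup S) : FreeGroup S →* FreeGroup S :=
  FreeGroup.lift (fun s => if s = z then u * FreeGroup.of z * u' else FreeGroup.of s)

theorem twoSided_of_mem_closure (z : S) (u u' v : FreeGroup S)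
    (hv : v ∈ Subgroup.closure (FreeGroup.of '' {s : S | s ≠ z})) : twoSided z u u' v = v := by
  have h : Subgroup.closure (FreeGroup.of '' {s : S | s ≠ z}) ≤
      (twoSided z u u').eqLocus (MonoidHom.id _) := by
    rw [Subgroup.closure_le]
    rintro _ ⟨s, hs, rfl⟩
    have hs' : s ≠ z := hs
    change twoSided z u u' (FreeGroup.of s) = FreeGroup.of s
    simp [twoSided, hs']
  exact h hv

theorem twoSided_comp (z : S) (u u' v v' : FreeGroup S)
    (hv : v ∈ Subgroup.closure (FreeGroup.of '' {s : S | s ≠ z}))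
    (hv' : v' ∈ Subgroup.closure (FreeGroup.of '' {s : S | s ≠ z}))
    (h : v * u = 1) (h' : u' * v' = 1) (w : FreeGroup S) :
    twoSided z u u' (twoSided z v v' w) = w := by
  have e : (twoSided z u u').comp (twoSided z v v') = MonoidHom.id _ := by
    ext s
    by_cases hs : s = z
    · subst hs
      have h1 : twoSided s v v' (FreeGroup.of s) = v * FreeGroup.of s * v' := by simp [twoSided]
      have h2 : twoSided s u u' (FreeGroup.of s) = u * FreeGroup.of s * u' := by simp [twoSided]
      rw [MonoidHom.comp_apply, h1, map_mul, map_mul, h2, twoSided_of_mem_closure s u u' v hv,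
        twoSided_of_mem_closure s u u' v' hv', MonoidHom.id_apply]
      calc v * (u * FreeGroup.of s * u') * v' = (v * u) * FreeGroup.of s * (u' * v') := by group
        _ = FreeGroup.of s := by rw [h, h']; simp
    · simp [twoSided, hs]
  exact DFunLike.congr_fun e w

/-- The transvection `M_{z,v}`: it sends `z` to `v z` and fixes all other basis elements. Here `v`
lies in the subgroup generated by the basis elements other than `z`. -/
def transvection (z : S) (v : FreeGroup S)
    (hv : v ∈ Subgroup.closure (FreeGroup.of '' {s : S | s ≠ z})) : MulAut (FreeGroup S) where
  toFun := twoSided z v 1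
  invFun := twoSided z v⁻¹ 1
  left_inv := twoSided_comp z _ _ _ _ hv (one_mem _) (by simp) (by simp)
  right_inv := twoSided_comp z _ _ _ _ (inv_mem hv) (one_mem _) (by simp) (by simp)
  map_mul' := map_mul _

/-- The conjugation move `C_{z,z'}` for `z ≠ z'`: it sends `z` to `z' z z'⁻¹` and fixes all other
basis elements. -/
def conjMove (z z' : S) (h : z' ≠ z) : MulAut (FreeGroup S) where
  toFun := twoSided z (FreeGroup.of z') (FreeGroup.of z')⁻¹
  invFun := twoSided z (FreeGroup.of z')⁻¹ (FreeGroup.of z')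
  left_inv := twoSided_comp z _ _ _ _ (of_mem_closure h) (inv_mem (of_mem_closure h))
    (by simp) (by simp)
  right_inv := twoSided_comp z _ _ _ _ (inv_mem (of_mem_closure h)) (of_mem_closure h)
    (by simp) (by simp)
  map_mul' := map_mul _

/-- The commutator transvection `M_{a,[b,c]}` for basis elements `b, c ≠ a`, where
`[b,c] = b c b⁻¹ c⁻¹`. -/
def commTransvection (a b c : S) (hb : b ≠ a) (hc : c ≠ a) : MulAut (FreeGroup S) :=
  transvection a ⁅FreeGroup.of b, FreeGroup.of c⁆
    (by
      rw [commutatorElement_def]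
      exact mul_mem (mul_mem (mul_mem (of_mem_closure hb) (of_mem_closure hc))
        (inv_mem (of_mem_closure hb))) (inv_mem (of_mem_closure hc)))

end Generators

/-- The set of all `M_{x,[y,z]}` with `x ∈ X`, `y ∈ Y`, `z ∈ (X ∪ Y) \ {x, y}`. -/
def commTransvections (n k : ℕ) : Set (MulAut (F n k)) :=
  {f | ∃ (i : Fin n) (j : Fin k) (z : Fin n ⊕ Fin k) (hx : z ≠ Sum.inl i) (_ : z ≠ Sum.inr j),
    f = commTransvection (Sum.inl i) (Sum.inr j) z Sum.inr_ne_inl hx}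

/-- The set of all `C_{y,z}` and `C_{z,y}` with `y ∈ Y` and `z ∈ (X ∪ Y) \ {y}`. -/
def conjMoves (n k : ℕ) : Set (MulAut (F n k)) :=
  {f | ∃ (j : Fin k) (z : Fin n ⊕ Fin k) (hz : z ≠ Sum.inr j),
    f = conjMove (Sum.inr j) z hz ∨ f = conjMove z (Sum.inr j) hz.symm}

end TorelliBirman

/-!
The proof computes generators for three groups in turn.

*Automorphisms preserving the conjugacy classes of the `y_j`* (`sup_eq_autFB`). This group is
generated by Nielsen's generators of `Aut(F_n)` together with the moves `x_i ↦ y_j x_i`,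
`x_i ↦ x_i y_j` and `y_j ↦ z y_j z⁻¹`. The argument is Nielsen reduction, relative to the `y_j`: in
each coset choose `f` that minimizes the total length of the images of the basis and then a
lexicographic weight of their initial halves. The image of `x_i` can be multiplied on either side by
other images and their inverses, while the image `w y_j w⁻¹` of `y_j` can only be conjugated by
them. Since the latter has odd length, with middle letter `y_j`, these moves are enough to make the
images of the basis Nielsen reduced (`LocallyMinimal.nielsenReduced`). Cancellation is measured by
Gromov products, and the `0`-hyperbolicity of the free group (`min_commonPrefix_le`) turns the local
condition into the inequality `|w| ≤ |f w|` for all `w` (`NielsenReduced.norm_le`). Hence `f⁻¹`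
permutes the basis elements up to inversion.

*The Birman kernel* (`birmanKernel_eq`). The group `kernelGroup` generated by the moves
that involve the `y_j` is normalized by Nielsen's generators, so that every element of the first
group is a product `ν γ` with `ν ∈ kernelGroup` and `γ` in the copy of `Aut(F_n)`, on which the map
to `Aut(F_n)` is injective. Therefore the kernel of that map is `kernelGroup`.

*The Torelli part* (`torelliGroup_eq`). The group `H` generated by the given finite set is
normalized by the transvections `x_i ↦ y_j x_i`, and together they generate the Birman kernel. So
every element of the kernel is `h p`, where `h ∈ H` and `p` is of the form `x_i ↦ v_i⁻¹ x_i` for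
words `v_i` in the `y_j`. If `h p` acts trivially on the abelianization, then so does `p`, each
`v_i` is a product of commutators, and `p ∈ H` because the words `u` for which `x_i ↦ u x_i` lies in
`H` form a subgroup that contains all `[y, y']` and is invariant under conjugation by the `y_j`.
-/

namespace TorelliBirman

/-! ### Common prefixes and cancellation in free groups -/

section Gromov

open FreeGroup

variable {α : Type*} [DecidableEq α]

/-- The length of the longest common prefix of the reduced words of `u` and `v`, defined as the
Gromov product of `u` and `v` for the word length. -/
def commonPrefix (u v : FreeGroup α) : ℕ := (u.norm + v.norm - (u⁻¹ * v).norm) / 2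

theorem exists_common_prefix_of_isReduced {L M : List (α × Bool)} (hL : IsReduced L)
    (hM : IsReduced M) :
    ∃ p a b, L = p ++ a ∧ M = p ++ b ∧ IsReduced (invRev a ++ b) := by
  induction L generalizing M with
  | nil => exact ⟨[], [], M, rfl, rfl, by simpa using hM⟩
  | cons s L ih =>
    have hinv : IsReduced (invRev (s :: L)) := by
      rw [isReduced_iff_reduce_eq, reduce_invRev, hL.reduce_eq]
    cases M with
    | nil => exact ⟨[], s :: L, [], rfl, rfl, by simpa using hinv⟩
    | cons t M =>
      by_cases hst : s = t
      · subst hst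
        obtain ⟨p, a, b, h1, h2, h3⟩ := ih (hL.infix (List.suffix_cons _ _).isInfix)
          (hM.infix (List.suffix_cons _ _).isInfix)
        exact ⟨s :: p, a, b, by simp [h1], by simp [h2], h3⟩
      · refine ⟨[], s :: L, t :: M, rfl, rfl, ?_⟩
        refine List.IsChain.append hinv hM ?_
        rintro c hc d hd h
        simp only [invRev, List.map_cons, List.reverse_cons, List.getLast?_concat,
          Option.mem_def, Option.some.injEq, List.head?_cons] at hc hd
        subst hc hd
        obtain ⟨s, e⟩ := s
        obtain ⟨t, e'⟩ := t
        cases e <;> cases e' <;> simp_all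

/-- Cancellation in `u⁻¹ * v` removes exactly the longest common prefix of `u` and `v`. -/
theorem exists_common_prefix (u v : FreeGroup α) :
    ∃ p a b, u.toWord = p ++ a ∧ v.toWord = p ++ b ∧ (u⁻¹ * v).toWord = invRev a ++ b ∧
      commonPrefix u v = p.length := by
  obtain ⟨p, a, b, h1, h2, h3⟩ :=
    exists_common_prefix_of_isReduced (isReduced_toWord (x := u)) (isReduced_toWord (x := v))
  have h4 : (u⁻¹ * v).toWord = invRev a ++ b := by
    have hu : u = mk p * mk a := by rw [mul_mk, ← h1, mk_toWord]
    have hv : v = mk p * mk b := by rw [mul_mk, ← h2, mk_toWord]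
    have : u⁻¹ * v = mk (invRev a ++ b) := by
      rw [← mul_mk, ← inv_mk, hu, hv]; group
    rw [this, toWord_mk, h3.reduce_eq]
  refine ⟨p, a, b, h1, h2, h4, ?_⟩
  simp only [commonPrefix, FreeGroup.norm, h1, h2, h4, List.length_append, invRev_length]
  omega

theorem norm_inv_mul_add (u v : FreeGroup α) :
    (u⁻¹ * v).norm + 2 * commonPrefix u v = u.norm + v.norm := by
  obtain ⟨p, a, b, h1, h2, h3, h4⟩ := exists_common_prefix u v
  simp only [h4, FreeGroup.norm, h1, h2, h3, List.length_append, invRev_length]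
  omega

theorem toWord_inv_mul (u v : FreeGroup α) :
    (u⁻¹ * v).toWord =
      invRev (u.toWord.drop (commonPrefix u v)) ++ v.toWord.drop (commonPrefix u v) := by
  obtain ⟨p, a, b, h1, h2, h3, h4⟩ := exists_common_prefix u v
  simp [h4, h1, h2, h3]

theorem le_commonPrefix_iff (u v : FreeGroup α) (m : ℕ) :
    m ≤ commonPrefix u v ↔
      m ≤ u.norm ∧ m ≤ v.norm ∧ u.toWord.take m = v.toWord.take m := by
  obtain ⟨p, a, b, h1, h2, h3, h4⟩ := exists_common_prefix u v
  simp only [FreeGroup.norm, h1, h2, h4]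
  constructor
  · intro h
    refine ⟨by simp; omega, by simp; omega, ?_⟩
    rw [List.take_append_of_le_length h, List.take_append_of_le_length h]
  · rintro ⟨ha, hb, h⟩
    by_contra hm
    have hred : IsReduced (invRev a ++ b) := h3 ▸ isReduced_toWord
    have h' := congrArg (List.drop p.length) h
    rw [List.length_append] at ha hb
    rw [List.drop_take, List.drop_take, List.drop_left, List.drop_left] at h'
    obtain _ | ⟨s, a⟩ := a
    · simp at ha; omega
    obtain _ | ⟨t, b⟩ := b
    · simp at hb; omega
    obtain ⟨k, hk⟩ : ∃ k, m - p.length = k + 1 := ⟨m - p.length - 1, by omega⟩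
    rw [hk, List.take_succ_cons, List.take_succ_cons, List.cons.injEq] at h'
    obtain ⟨rfl, -⟩ := h'
    have h5 := (List.isChain_append.1 hred).2.2 (s.1, !s.2) (by simp [invRev]) s (by simp)
    simp at h5

theorem commonPrefix_comm (u v : FreeGroup α) : commonPrefix u v = commonPrefix v u := by
  have h1 := norm_inv_mul_add u v
  have h2 := norm_inv_mul_add v u
  have h3 : (v⁻¹ * u).norm = (u⁻¹ * v).norm := by
    rw [← norm_inv_eq]; simp
  omega

/-- The word metric on a free group is `0`-hyperbolic. -/
theorem min_commonPrefix_le (u v w : FreeGroup α) :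
    min (commonPrefix u v) (commonPrefix v w) ≤ commonPrefix u w := by
  rw [le_commonPrefix_iff]
  obtain ⟨h1, h2, h3⟩ := (le_commonPrefix_iff u v _).1
    (min_le_left (commonPrefix u v) (commonPrefix v w))
  obtain ⟨h4, h5, h6⟩ := (le_commonPrefix_iff v w _).1
    (min_le_right (commonPrefix u v) (commonPrefix v w))
  exact ⟨h1, h5, h3.trans h6⟩

theorem commonPrefix_self (u : FreeGroup α) : commonPrefix u u = u.norm := by
  have := norm_inv_mul_add u u
  simp at this
  omega

theorem commonPrefix_inv_mul_left (u v : FreeGroup α) :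
    commonPrefix (u⁻¹ * v) u⁻¹ + commonPrefix u v = u.norm := by
  have h1 := norm_inv_mul_add u v
  have h2 := norm_inv_mul_add (u⁻¹ * v) u⁻¹
  have h3 : ((u⁻¹ * v)⁻¹ * u⁻¹).norm = v.norm := by
    rw [← norm_inv_eq]; simp
  rw [h3, norm_inv_eq] at h2
  omega

/-- A nontrivial element `u` cancels less than half of itself in `u * u`. -/
theorem two_mul_commonPrefix_inv_lt {u : FreeGroup α} (hu : u ≠ 1) :
    2 * commonPrefix u u⁻¹ < u.norm := by
  by_contra! hc
  obtain ⟨L, hL⟩ : ∃ L, L = u.toWord := ⟨_, rfl⟩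
  obtain ⟨h1, h2, h3⟩ := (le_commonPrefix_iff u u⁻¹ _).1 le_rfl
  set m := commonPrefix u u⁻¹
  rw [toWord_inv, ← hL] at h3
  have hn : u.norm = L.length := by rw [hL, FreeGroup.norm]
  rw [hn] at hc h1
  have hpos : 0 < L.length := by
    rw [← hn, Nat.pos_iff_ne_zero, Ne, FreeGroup.norm_eq_zero]
    exact hu
  have key : ∀ i (hi : i < m), L[i]'(by omega) =
      ((L[L.length - 1 - i]'(by omega)).1, !(L[L.length - 1 - i]'(by omega)).2) := by
    intro i hi
    have h4 : (L.take m)[i]? = ((invRev L).take m)[i]? := by rw [h3]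
    rw [List.getElem?_take_of_lt hi, List.getElem?_take_of_lt hi, List.getElem?_eq_getElem (by omega),
      List.getElem?_eq_getElem (by rw [invRev_length]; omega), Option.some.injEq] at h4
    rw [h4]
    simp [invRev]
  rcases Nat.even_or_odd' L.length with ⟨h, hh | hh⟩
  · have h5 := key (h - 1) (by omega)
    have hred : IsReduced L := hL ▸ isReduced_toWord
    have h6 := List.isChain_iff_getElem.1 hred (h - 1) (by omega)
    have e : L.length - 1 - (h - 1) = h - 1 + 1 := by omega
    simp only [e] at h5
    rw [h5] at h6
    simp at h6
  · have h5 := key h (by omega)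
    have e : L.length - 1 - h = h := by omega
    simp only [e] at h5
    have := congrArg Prod.snd h5
    simp at this

end Gromov

/-! ### Nielsen reduced families -/

section Nielsen

open FreeGroup hiding map_inv map_mul

variable {α β : Type*}

/-- The inverse of a signed basis element. -/
def flip (s : α × Bool) : α × Bool := (s.1, !s.2)

theorem flip_ne_self (s : α × Bool) : flip s ≠ s := by
  intro h
  simpa [flip] using congrArg Prod.snd h

theorem mk_flip (s : α × Bool) : mk [flip s] = (mk [s])⁻¹ := by
  simp [flip, invRev]

variable [DecidableEq β]

/-- The images under `f` of the signed basis elements satisfy Nielsen's condition: in a product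
of three of them that does not contain two adjacent mutually inverse ones, the middle factor is not
entirely cancelled. -/
def NielsenReduced (f : FreeGroup α →* FreeGroup β) : Prop :=
  ∀ s t r : α × Bool, s ≠ t → r ≠ flip t →
    commonPrefix (f (mk [s])) (f (mk [t])) + commonPrefix (f (mk [t]))⁻¹ (f (mk [r])) <
      (f (mk [t])).norm

/-- The induction on the length of a word behind `NielsenReduced.norm_le`: the image of a word
starting with `t` shares with `f t` a prefix longer than any cancellation on the left of `f t`. -/
theorem NielsenReduced.induction {f : FreeGroup α →* FreeGroup β} (hf : NielsenReduced f)
    (L : List (α × Bool)) (t : α × Bool) (hL : IsReduced (t :: L)) :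
    (∀ s, s ≠ t → commonPrefix (f (mk [s])) (f (mk [t])) <
      commonPrefix (f (mk [t])) (f (mk (t :: L)))) ∧
    L.length + commonPrefix (f (mk [t])) (f (mk (t :: L))) ≤ (f (mk (t :: L))).norm := by
  induction L generalizing t with
  | nil =>
    simp only [commonPrefix_self, List.length_nil, zero_add, le_refl, and_true]
    intro s hs
    have := hf s t t hs (flip_ne_self t).symm
    omega
  | cons r L ih =>
    obtain ⟨ih1, ih2⟩ := ih r (hL.infix (List.suffix_cons _ _).isInfix)
    have hrt : flip t ≠ r := by
      rintro rfl
      simp [flip] at hL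
    have hmul : f (mk (t :: r :: L)) = (f (mk [flip t]))⁻¹ * f (mk (r :: L)) := by
      rw [mk_flip, map_inv, inv_inv, ← map_mul, mul_mk]; rfl
    have ht : f (mk [t]) = (f (mk [flip t]))⁻¹ := by rw [mk_flip, map_inv, inv_inv]
    have hpre : commonPrefix (f (mk [flip t])) (f (mk (r :: L))) =
        commonPrefix (f (mk [flip t])) (f (mk [r])) := by
      have h1 := min_commonPrefix_le (f (mk [flip t])) (f (mk [r])) (f (mk (r :: L)))
      have h2 := min_commonPrefix_le (f (mk [flip t])) (f (mk (r :: L))) (f (mk [r]))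
      have h3 := ih1 _ hrt
      rw [commonPrefix_comm (f (mk (r :: L)))] at h2
      omega
    have h4 := commonPrefix_inv_mul_left (f (mk [flip t])) (f (mk (r :: L)))
    rw [hpre, ← hmul, ← ht, commonPrefix_comm] at h4
    have h5 := norm_inv_mul_add (f (mk [flip t])) (f (mk (r :: L)))
    rw [hpre, ← hmul] at h5
    have hn : (f (mk [flip t])).norm = (f (mk [t])).norm := by
      rw [ht, norm_inv_eq]
    refine ⟨fun s hs => ?_, ?_⟩
    · have h6 := hf s t r hs hrt.symm
      rw [ht, inv_inv, ← ht] at h6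
      omega
    · have h7 := ih1 _ hrt
      simp only [List.length_cons]
      omega

/-- A homomorphism with Nielsen reduced images does not shorten words. -/
theorem NielsenReduced.norm_le [DecidableEq α] {f : FreeGroup α →* FreeGroup β} (hf : NielsenReduced f)
    (w : FreeGroup α) : w.norm ≤ (f w).norm := by
  obtain ⟨L, hL⟩ : ∃ L, L = w.toWord := ⟨_, rfl⟩
  have hred : IsReduced L := hL ▸ isReduced_toWord
  have hw : w = mk L := by rw [hL, mk_toWord]
  have hn : w.norm = L.length := by rw [hL, FreeGroup.norm]
  rw [hn, hw]
  cases L with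
  | nil => simp
  | cons t L =>
    obtain ⟨h1, h2⟩ := hf.induction L t hred
    have := h1 _ (flip_ne_self t)
    simp only [List.length_cons]
    omega

end Nielsen

/-! ### Lexicographic codes of words -/

section Code

variable {β : Type*}

/-- Reading words as numbers in a base larger than the alphabet orders the words of each length
lexicographically. -/
theorem exists_lexicographic_code (β : Type*) [Finite β] :
    ∃ code : List β → ℕ,
      (∀ p q, p.length = q.length → code p = code q → p = q) ∧
      ∀ p q c, code p < code q → code (p ++ c) < code (q ++ c) := by
  obtain ⟨n, ⟨e⟩⟩ := Finite.exists_equiv_fin β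
  refine ⟨fun l => Nat.ofDigits (n + 2) (l.reverse.map fun b => (e b : ℕ)), ?_, ?_⟩
  · intro p q hpq h
    have := Nat.ofDigits_inj_of_len_eq (by omega) (by simpa using hpq)
      (by simp; intros; omega) (by simp; intros; omega) h
    have hinj : Function.Injective fun b => (e b : ℕ) := Fin.val_injective.comp e.injective
    exact List.reverse_injective (hinj.list_map this)
  · intro p q c h
    simp only [List.reverse_append, List.map_append, Nat.ofDigits_append]
    gcongr

variable {α : Type*} [DecidableEq α]

/-- The initial half of the reduced word of `g`, without the middle letter. -/
def half (g : FreeGroup α) : List (α × Bool) := g.toWord.take (g.norm / 2)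

/-- The secondary complexity of an element, for a given `code` of words by natural numbers: the sum
of the codes of the initial halves of the element and of its inverse. -/
def weight (code : List (α × Bool) → ℕ) (g : FreeGroup α) : ℕ := code (half g) + code (half g⁻¹)

theorem length_half (g : FreeGroup α) : (half g).length = g.norm / 2 := by
  have : g.toWord.length = g.norm := rfl
  rw [half, List.length_take, this]
  omega

theorem weight_inv (code : List (α × Bool) → ℕ) (g : FreeGroup α) :
    weight code g⁻¹ = weight code g := by
  rw [weight, weight, inv_inv, add_comm]

theorem half_eq_toWord {g w : FreeGroup α} (h : g.norm = 2 * w.norm + 1)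
    (hw : w.norm ≤ commonPrefix g w) : half g = w.toWord := by
  rw [half, h, show (2 * w.norm + 1) / 2 = w.norm by omega,
    ((le_commonPrefix_iff _ _ _).1 hw).2.2]
  exact List.take_length

/-- If the second half of `b` cancels in `b * c` and nothing else does, then the first half of `b`
replaces a prefix of `c`. -/
theorem toWord_mul_of_half {b c : FreeGroup α} {m : ℕ} (hb : b.norm = 2 * m)
    (hbc : commonPrefix b⁻¹ c = m) : (b * c).toWord = half b ++ c.toWord.drop m := by
  have h := toWord_inv_mul b⁻¹ c
  rw [inv_inv, hbc, FreeGroup.toWord_inv] at h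
  rw [h, half, hb]
  have h1 : b.toWord.length = 2 * m := hb
  congr 1
  rw [← FreeGroup.invRev_injective.eq_iff, FreeGroup.invRev_invRev]
  simp only [FreeGroup.invRev, List.drop_reverse, List.map_take]
  simp only [List.length_map, h1]
  congr 2
  omega

theorem toWord_eq_half_append {b c : FreeGroup α} {m : ℕ} (hb : b.norm = 2 * m)
    (hbc : commonPrefix b c = m) : c.toWord = half b ++ c.toWord.drop m := by
  have h1 := ((le_commonPrefix_iff b c m).1 hbc.ge).2.2
  rw [half, hb, Nat.mul_div_cancel_left _ two_pos, h1, List.take_append_drop]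

/-- Replacing the initial half `q` of `c` by the word `p`, where `b = p q⁻¹` without cancellation,
changes the first half of `c` and nothing else. -/
theorem weight_mul_lt {code : List (α × Bool) → ℕ}
    (hcode : ∀ p q c, code p < code q → code (p ++ c) < code (q ++ c))
    {b c : FreeGroup α} {m : ℕ} (hb : b.norm = 2 * m) (hbc : commonPrefix b⁻¹ c = m)
    (hc : 2 * m ≤ c.norm) (hlt : code (half b) < code (half b⁻¹)) :
    weight code (b * c) < weight code c := by
  have hw := toWord_mul_of_half hb hbc
  have hhb : (half b).length = m := by
    rw [length_half, hb]; omega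
  have hhb' : (half b⁻¹).length = m := by
    rw [length_half, FreeGroup.norm_inv_eq, hb]; omega
  have hn : (b * c).norm = c.norm := by
    have := norm_inv_mul_add b⁻¹ c
    rw [inv_inv, FreeGroup.norm_inv_eq, hb, hbc] at this
    omega
  have hcw := toWord_eq_half_append (FreeGroup.norm_inv_eq.trans hb) hbc
  have hlen : c.toWord.length = c.norm := rfl
  obtain ⟨d, hd⟩ : ∃ d, d = c.toWord.drop m := ⟨_, rfl⟩
  have hdl : d.length = c.norm - m := by rw [hd, List.length_drop, hlen]
  rw [← hd] at hw hcw
  have e1 : half c = half b⁻¹ ++ d.take (c.norm / 2 - m) := by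
    rw [half, hcw, List.take_append, List.take_of_length_le (by omega), hhb']
  have e2 : half (b * c) = half b ++ d.take (c.norm / 2 - m) := by
    rw [half, hw, hn, List.take_append, List.take_of_length_le (by omega), hhb]
  have e3 : half c⁻¹ = (FreeGroup.invRev d).take (c.norm / 2) := by
    rw [half, FreeGroup.norm_inv_eq, FreeGroup.toWord_inv, hcw, FreeGroup.invRev_append,
      List.take_append_of_le_length (by rw [FreeGroup.invRev_length]; omega)]
  have e4 : half (b * c)⁻¹ = (FreeGroup.invRev d).take (c.norm / 2) := by
    rw [half, FreeGroup.norm_inv_eq, FreeGroup.toWord_inv, hw, hn, FreeGroup.invRev_append,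
      List.take_append_of_le_length (by rw [FreeGroup.invRev_length]; omega)]
  rw [weight, weight, e1, e2, e3, e4]
  have := hcode _ _ (d.take (c.norm / 2 - m)) hlt
  omega

end Code

/-! ### Endomorphisms of minimal complexity -/

section Minimal

open FreeGroup hiding map_inv map_mul

variable {ι κ : Type*} [DecidableEq ι] [DecidableEq κ]

/-- The image of the signed basis element `t` after the elementary move that multiplies it by
`s⁻¹` on the left if it belongs to the first family `ι`, and conjugates it by `s⁻¹` if it belongs to
the second family `κ`. -/
def moved (f : FreeGroup (ι ⊕ κ) →* FreeGroup (ι ⊕ κ)) (s t : (ι ⊕ κ) × Bool) :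
    FreeGroup (ι ⊕ κ) :=
  match t.1 with
  | .inl _ => (f (mk [s]))⁻¹ * f (mk [t])
  | .inr _ => (f (mk [s]))⁻¹ * f (mk [t]) * f (mk [s])

/-- No elementary move decreases the length of the image of a basis element, or its weight while
keeping its length. -/
def LocallyMinimal (code : List ((ι ⊕ κ) × Bool) → ℕ)
    (f : FreeGroup (ι ⊕ κ) →* FreeGroup (ι ⊕ κ)) : Prop :=
  ∀ s t : (ι ⊕ κ) × Bool, s.1 ≠ t.1 → (f (mk [t])).norm ≤ (moved f s t).norm ∧
    ((f (mk [t])).norm = (moved f s t).norm → weight code (f (mk [t])) ≤ weight code (moved f s t))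

/-- `g` is the reduced conjugate of the letter `t` by `w`. -/
def IsReducedConj (g : FreeGroup (ι ⊕ κ)) (t : (ι ⊕ κ) × Bool) (w : FreeGroup (ι ⊕ κ)) : Prop :=
  g = w * mk [t] * w⁻¹ ∧ g.norm = 2 * w.norm + 1

theorem norm_mk_singleton (t : (ι ⊕ κ) × Bool) : (mk [t]).norm = 1 := by
  simp [FreeGroup.norm]

section

variable {g w : FreeGroup (ι ⊕ κ)} {t : (ι ⊕ κ) × Bool} (h : IsReducedConj g t w)
include h

theorem IsReducedConj.norm_le_commonPrefix : w.norm ≤ commonPrefix g w := by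
  have h1 := norm_inv_mul_add w g
  have h2 : w⁻¹ * g = mk [t] * w⁻¹ := by rw [h.1]; group
  have h3 := norm_mul_le (mk [t]) w⁻¹
  rw [norm_inv_eq, norm_mk_singleton] at h3
  rw [h2, h.2, commonPrefix_comm] at h1
  omega

theorem IsReducedConj.norm_mul_letter :
    (w * mk [t]).norm = w.norm + 1 ∧ w.norm + 1 ≤ commonPrefix g (w * mk [t]) := by
  have h1 := norm_inv_mul_add (w * mk [t]) g
  have h2 : (w * mk [t])⁻¹ * g = w⁻¹ := by rw [h.1]; group
  have h3 := norm_mul_le (w * mk [t]) w⁻¹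
  have h4 := norm_mul_le w (mk [t])
  rw [← h.1, h.2, norm_inv_eq] at h3
  rw [norm_mk_singleton] at h4
  rw [h2, h.2, commonPrefix_comm, norm_inv_eq] at h1
  omega

theorem IsReducedConj.half_eq : half g = w.toWord :=
  half_eq_toWord h.2 h.norm_le_commonPrefix

theorem IsReducedConj.inv : IsReducedConj g⁻¹ (flip t) w := by
  refine ⟨?_, by rw [norm_inv_eq, h.2]⟩
  rw [mk_flip, h.1]
  group

end

variable {code : List ((ι ⊕ κ) × Bool) → ℕ} {f : FreeGroup (ι ⊕ κ) →* FreeGroup (ι ⊕ κ)}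

/-- In a locally minimal family, conjugators of elements of the second family are not
shortened by multiplication. -/
theorem LocallyMinimal.two_mul_commonPrefix_conjugator_le (hf : LocallyMinimal code f)
    {s : (ι ⊕ κ) × Bool} {j : κ} {e : Bool} (hst : s.1 ≠ .inr j) {w : FreeGroup (ι ⊕ κ)}
    (hw : IsReducedConj (f (mk [(.inr j, e)])) (.inr j, e) w) :
    2 * commonPrefix (f (mk [s])) w ≤ (f (mk [s])).norm := by
  have h1 := (hf s (.inr j, e) hst).1
  have h2 : moved f s (.inr j, e) =
      ((f (mk [s]))⁻¹ * w) * mk [(.inr j, e)] * ((f (mk [s]))⁻¹ * w)⁻¹ := by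
    simp only [moved]
    rw [hw.1]; group
  have h3 := norm_mul_le ((f (mk [s]))⁻¹ * w * mk [(.inr j, e)]) ((f (mk [s]))⁻¹ * w)⁻¹
  have h4 := norm_mul_le ((f (mk [s]))⁻¹ * w) (mk [(.inr j, e)])
  have h5 := norm_inv_mul_add (f (mk [s])) w
  rw [norm_inv_eq, ← h2] at h3
  rw [norm_mk_singleton] at h4
  have := hw.2
  omega

theorem LocallyMinimal.two_mul_commonPrefix_le_of_inl (hf : LocallyMinimal code f)
    {s : (ι ⊕ κ) × Bool} {i : ι} {e : Bool} (hst : s.1 ≠ .inl i) :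
    2 * commonPrefix (f (mk [s])) (f (mk [(.inl i, e)])) ≤ (f (mk [s])).norm := by
  have h1 := (hf s (.inl i, e) hst).1
  have h5 := norm_inv_mul_add (f (mk [s])) (f (mk [(.inl i, e)]))
  simp only [moved] at h1
  omega

/-- Nielsen's first condition: at most half of an element cancels against another one. -/
theorem LocallyMinimal.two_mul_commonPrefix_le (hf : LocallyMinimal code f)
    (hinj : Function.Injective f)
    (hconj : ∀ j e, ∃ w, IsReducedConj (f (mk [(.inr j, e)])) (.inr j, e) w)
    {s t : (ι ⊕ κ) × Bool} (hst : s ≠ t) :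
    2 * commonPrefix (f (mk [s])) (f (mk [t])) ≤ (f (mk [s])).norm := by
  by_cases hb : s.1 = t.1
  · have ht : t = flip s := by
      obtain ⟨s, e⟩ := s
      obtain ⟨t, e'⟩ := t
      cases e <;> cases e' <;> simp_all [flip]
    rw [ht, mk_flip, map_inv]
    refine (two_mul_commonPrefix_inv_lt ?_).le
    rw [Ne, map_eq_one_iff f hinj]
    intro h
    have := norm_mk_singleton s
    simp [h] at this
  · obtain ⟨t | j, e⟩ := t
    · exact hf.two_mul_commonPrefix_le_of_inl hb
    · obtain ⟨w, hw⟩ := hconj j e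
      have h1 := hf.two_mul_commonPrefix_conjugator_le hb hw
      have h2 := min_commonPrefix_le (f (mk [s])) (f (mk [(.inr j, e)])) w
      have h3 := hw.norm_le_commonPrefix
      by_contra! hlt
      have h4 := hw.2
      obtain ⟨i | i, e'⟩ := s
      · have h5 := hf.two_mul_commonPrefix_le_of_inl (s := (.inr j, e)) (i := i) (e := e')
          (Ne.symm hb)
        rw [commonPrefix_comm] at h5
        omega
      · obtain ⟨v, hv⟩ := hconj i e'
        have h5 := hf.two_mul_commonPrefix_conjugator_le (Ne.symm hb) hv
        have h6 := min_commonPrefix_le (f (mk [(.inr j, e)])) (f (mk [(.inr i, e')])) v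
        have h7 := hv.norm_le_commonPrefix
        have h7' := h7
        have h8 := hv.2
        rw [commonPrefix_comm] at h6
        -- Both conjugators have the same length, and the cancellation reaches the middle letters.
        obtain ⟨h9, h10⟩ := hw.norm_mul_letter
        obtain ⟨h11, h12⟩ := hv.norm_mul_letter
        have h13 := min_commonPrefix_le (v * mk [(Sum.inr i, e')]) (f (mk [(.inr i, e')]))
          (f (mk [(.inr j, e)]))
        have h14 := min_commonPrefix_le (v * mk [(Sum.inr i, e')]) (f (mk [(.inr j, e)]))
          (w * mk [(Sum.inr j, e)])
        have h15 := min_commonPrefix_le v (f (mk [(.inr i, e')])) (f (mk [(.inr j, e)]))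
        have h16 := min_commonPrefix_le v (f (mk [(.inr j, e)])) w
        rw [commonPrefix_comm] at h12 h7
        have h17 := norm_inv_mul_add (v * mk [(Sum.inr i, e')]) (w * mk [(Sum.inr j, e)])
        have h18 := norm_inv_mul_add v w
        have h19 : (v⁻¹ * w).norm = 0 := by omega
        have h20 : ((v * mk [(Sum.inr i, e')])⁻¹ * (w * mk [(Sum.inr j, e)])).norm = 0 := by omega
        rw [FreeGroup.norm_eq_zero, inv_mul_eq_one] at h19 h20
        rw [h19] at h20
        have h21 := congrArg FreeGroup.toWord (mul_left_cancel h20)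
        simp at h21
        exact hb (by simp [h21.1])

/-- If the second half of `f t` cancels completely against `f r`, then the code of the first half
of `f t` is at least that of the first half of its inverse: otherwise `r` could be multiplied by
`t`. -/
theorem LocallyMinimal.code_half_inv_le
    (hcode : ∀ p q c, code p < code q → code (p ++ c) < code (q ++ c))
    (hf : LocallyMinimal code f) (hinj : Function.Injective f)
    (hconj : ∀ j e, ∃ w, IsReducedConj (f (mk [(.inr j, e)])) (.inr j, e) w)
    {t r : (ι ⊕ κ) × Bool} (htr : t.1 ≠ r.1) {m : ℕ} (hm : (f (mk [t])).norm = 2 * m)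
    (hc : commonPrefix (f (mk [t]))⁻¹ (f (mk [r])) = m) :
    code (half (f (mk [t]))⁻¹) ≤ code (half (f (mk [t]))) := by
  by_contra! hlt
  have hft : f (mk [flip t]) = (f (mk [t]))⁻¹ := by rw [mk_flip, map_inv]
  obtain ⟨h1, h2⟩ := hf (flip t) r htr
  have hrt : r ≠ flip t := by
    rintro rfl
    exact htr rfl
  have h3 := hf.two_mul_commonPrefix_le hinj hconj hrt
  rw [hft, commonPrefix_comm, hc] at h3
  have h4 := norm_inv_mul_add (f (mk [t]))⁻¹ (f (mk [r]))
  rw [inv_inv, norm_inv_eq, hm, hc] at h4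
  obtain ⟨i | j, e⟩ := r
  · simp only [moved, hft, inv_inv] at h2
    have h5 := weight_mul_lt hcode hm hc h3 hlt
    have := h2 (by omega)
    omega
  · obtain ⟨w, hw⟩ := hconj j e
    have h5 := hf.two_mul_commonPrefix_conjugator_le (s := flip t) htr hw
    rw [hft, norm_inv_eq, hm] at h5
    have h6 := min_commonPrefix_le (f (mk [t]))⁻¹ (f (mk [(.inr j, e)])) w
    have h7 := hw.norm_le_commonPrefix
    have h8 := hw.2
    have h9 : commonPrefix (f (mk [t]))⁻¹ w = m := by omega
    have h10 := norm_inv_mul_add (f (mk [t]))⁻¹ w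
    rw [inv_inv, norm_inv_eq, hm, h9] at h10
    have h11 : moved f (flip t) (.inr j, e) =
        (f (mk [t]) * w) * mk [(.inr j, e)] * (f (mk [t]) * w)⁻¹ := by
      simp only [moved, hft]
      rw [hw.1]; group
    have h12 := norm_mul_le (f (mk [t]) * w * mk [(.inr j, e)]) (f (mk [t]) * w)⁻¹
    have h13 := norm_mul_le (f (mk [t]) * w) (mk [(.inr j, e)])
    rw [norm_inv_eq, ← h11] at h12
    rw [norm_mk_singleton] at h13
    have h14 : IsReducedConj (moved f (flip t) (.inr j, e)) (.inr j, e) (f (mk [t]) * w) :=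
      ⟨h11, by omega⟩
    have h15 := h2 (by omega)
    rw [weight, weight, hw.half_eq, hw.inv.half_eq, h14.half_eq, h14.inv.half_eq,
      toWord_mul_of_half hm h9] at h15
    have h17 := congrArg code (toWord_eq_half_append (norm_inv_eq.trans hm) h9)
    have h16 := hcode _ _ (w.toWord.drop m) hlt
    omega

/-- Nielsen's second condition: if both halves of the middle factor were cancelled, then comparing
their codes in both directions would make them equal, and the factor trivial. -/
theorem LocallyMinimal.nielsenReduced
    (hcode : ∀ p q c, code p < code q → code (p ++ c) < code (q ++ c))
    (hcode_inj : ∀ p q, p.length = q.length → code p = code q → p = q)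
    (hf : LocallyMinimal code f) (hinj : Function.Injective f)
    (hconj : ∀ j e, ∃ w, IsReducedConj (f (mk [(.inr j, e)])) (.inr j, e) w) :
    NielsenReduced f := by
  intro s t r hst hrt
  have hft : f (mk [flip t]) = (f (mk [t]))⁻¹ := by rw [mk_flip, map_inv]
  have h1 := hf.two_mul_commonPrefix_le hinj hconj hst.symm
  have h2 := hf.two_mul_commonPrefix_le hinj hconj hrt.symm
  have hne : f (mk [t]) ≠ 1 := by
    rw [Ne, map_eq_one_iff f hinj]
    intro h
    have := norm_mk_singleton t
    simp [h] at this
  rw [hft, norm_inv_eq] at h2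
  rw [commonPrefix_comm] at h1
  by_contra! hlt
  set m := commonPrefix (f (mk [t]))⁻¹ (f (mk [r])) with hm
  have hn : (f (mk [t])).norm = 2 * m := by omega
  have hs : commonPrefix (f (mk [t])) (f (mk [s])) = m := by rw [commonPrefix_comm]; omega
  have hlt2 := two_mul_commonPrefix_inv_lt hne
  have hst' : t.1 ≠ s.1 := by
    intro h
    have : s = flip t := by
      obtain ⟨s, e⟩ := s
      obtain ⟨t, e'⟩ := t
      cases e <;> cases e' <;> simp_all [flip]
    rw [this, hft] at hs
    omega
  have hrt' : t.1 ≠ r.1 := by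
    intro h
    have : r = t := by
      obtain ⟨r, e⟩ := r
      obtain ⟨t, e'⟩ := t
      cases e <;> cases e' <;> simp_all [flip]
    rw [this, commonPrefix_comm] at hm
    omega
  have h3 := hf.code_half_inv_le hcode hinj hconj hrt' hn hm.symm
  have h4 := hf.code_half_inv_le hcode hinj hconj (t := flip t) (r := s) (m := m) hst'
    (by rw [hft, norm_inv_eq, hn]) (by rw [hft, inv_inv, hs])
  rw [hft, inv_inv] at h4
  have h5 := hcode_inj _ _ (by rw [length_half, length_half, norm_inv_eq]) (le_antisymm h4 h3)
  -- The two halves agree, so that half of `f t` cancels in its square.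
  have h6 : m ≤ commonPrefix (f (mk [t])) (f (mk [t]))⁻¹ := by
    rw [le_commonPrefix_iff, norm_inv_eq]
    refine ⟨by omega, by omega, ?_⟩
    rw [half, half, norm_inv_eq, hn, Nat.mul_div_cancel_left _ two_pos] at h5
    exact h5
  omega

end Minimal

/-! ### Elementary automorphisms -/

section Moves

open FreeGroup hiding map_inv map_mul map_one

variable {S : Type*}

/-- The subgroup generated by the basis elements other than `z`. -/
def rest (z : S) : Subgroup (FreeGroup S) := Subgroup.closure (of '' {s : S | s ≠ z})

theorem of_mem_rest {z s : S} (h : s ≠ z) : of s ∈ rest z := of_mem_closure h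

theorem mk_mem_rest {z s : S} (h : s ≠ z) (e : Bool) : mk [(s, e)] ∈ rest z := by
  cases e
  · exact inv_mem (of_mem_rest h)
  · exact of_mem_rest h

theorem mulAut_ext {f g : MulAut (FreeGroup S)} (h : ∀ s, f (of s) = g (of s)) : f = g := by
  have : f.toMonoidHom = g.toMonoidHom := ext_hom _ _ h
  exact MulEquiv.toMonoidHom_injective this

/-- To see that `g` conjugates `t` to `r`, compare `g ∘ t` and `r ∘ g` on the basis. -/
theorem conj_eq_of_forall {g t r : MulAut (FreeGroup S)}
    (h : ∀ s, g (t (of s)) = r (g (of s))) : g * t * g⁻¹ = r := by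
  rw [mul_inv_eq_iff_eq_mul]
  exact mulAut_ext h

variable [DecidableEq S]

/-- The automorphism `z ↦ u z u'` fixing all other basis elements, where `u` and `u'` lie in the
subgroup generated by the basis elements other than `z`. -/
def mv (z : S) (u u' : FreeGroup S) (hu : u ∈ rest z) (hu' : u' ∈ rest z) :
    MulAut (FreeGroup S) where
  toFun := twoSided z u u'
  invFun := twoSided z u⁻¹ u'⁻¹
  left_inv := twoSided_comp z _ _ _ _ hu hu' (by simp) (by simp)
  right_inv := twoSided_comp z _ _ _ _ (inv_mem hu) (inv_mem hu') (by simp) (by simp)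
  map_mul' := map_mul _

variable {z : S} {u u' v v' : FreeGroup S} (hu : u ∈ rest z) (hu' : u' ∈ rest z)

@[simp]
theorem mv_of_self : mv z u u' hu hu' (of z) = u * of z * u' := by
  change twoSided z u u' (of z) = _
  simp [twoSided]

theorem mv_of_ne {s : S} (h : s ≠ z) : mv z u u' hu hu' (of s) = of s := by
  change twoSided z u u' (of s) = _
  simp [twoSided, h]

theorem mv_of_mem_rest (hv : v ∈ rest z) : mv z u u' hu hu' v = v :=
  twoSided_of_mem_closure z u u' v hv

theorem mv_mul (hv : v ∈ rest z) (hv' : v' ∈ rest z) :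
    mv z u u' hu hu' * mv z v v' hv hv' = mv z (v * u) (u' * v') (mul_mem hv hu)
      (mul_mem hu' hv') := by
  refine mulAut_ext fun s => ?_
  rw [MulAut.mul_apply]
  by_cases hs : s = z
  · subst hs
    simp only [mv_of_self, map_mul, mv_of_mem_rest _ _ hv, mv_of_mem_rest _ _ hv', mul_assoc]
  · simp only [mv_of_ne _ _ hs]

theorem mv_one : mv z 1 1 (one_mem _) (one_mem _) = 1 := by
  refine mulAut_ext fun s => ?_
  by_cases hs : s = z
  · subst hs; simp
  · rw [mv_of_ne _ _ hs]; rfl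

theorem mv_inv : (mv z u u' hu hu')⁻¹ = mv z u⁻¹ u'⁻¹ (inv_mem hu) (inv_mem hu') := by
  rw [inv_eq_iff_mul_eq_one, mv_mul]
  simp [mv_one]

theorem mv_congr (h : u = v) (h' : u' = v') :
    mv z u u' hu hu' = mv z v v' (h ▸ hu) (h' ▸ hu') := by
  subst h h'; rfl

/-- If `g` fixes `z` and preserves `rest z`, then conjugation by `g` applies `g` to the factors of
the move. -/
theorem conj_mv {g : MulAut (FreeGroup S)} (hz : g (of z) = of z)
    (hg : ∀ s, s ≠ z → g (of s) ∈ rest z) (hgu : g u ∈ rest z) (hgu' : g u' ∈ rest z) :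
    g * mv z u u' hu hu' * g⁻¹ = mv z (g u) (g u') hgu hgu' := by
  refine conj_eq_of_forall fun s => ?_
  by_cases hs : s = z
  · subst hs
    simp [hz]
  · rw [mv_of_ne _ _ hs, mv_of_mem_rest _ _ (hg s hs)]

/-- The endomorphism inverting one basis element. -/
def inversionHom (a : S) : FreeGroup S →* FreeGroup S :=
  lift (fun s => if s = a then (of s)⁻¹ else of s)

theorem inversionHom_involutive (a : S) : Function.Involutive (inversionHom a) := by
  have h : (inversionHom a).comp (inversionHom a) = MonoidHom.id _ := by
    ext s
    by_cases hs : s = a <;> simp [inversionHom, hs]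
  exact DFunLike.congr_fun h

/-- The inversion of one basis element, as an automorphism. -/
def inversion (a : S) : MulAut (FreeGroup S) where
  toFun := inversionHom a
  invFun := inversionHom a
  left_inv := inversionHom_involutive a
  right_inv := inversionHom_involutive a
  map_mul' := map_mul _

theorem inversion_of_self (a : S) : inversion a (of a) = (of a)⁻¹ := by
  change inversionHom a (of a) = _
  simp [inversionHom]

theorem inversion_of_ne {a s : S} (h : s ≠ a) : inversion a (of s) = of s := by
  change inversionHom a (of s) = _
  simp [inversionHom, h]

theorem inversion_inv (a : S) : (inversion a)⁻¹ = inversion a := rfl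

end Moves

/-! ### Subgroups generated by moves -/

section Subgroups

open FreeGroup hiding map_inv map_mul map_one

theorem conj_mem_closure {G : Type*} [Group G] {T : Set G} {g : G}
    (h : ∀ t ∈ T, g * t * g⁻¹ ∈ Subgroup.closure T) {t : G} (ht : t ∈ Subgroup.closure T) :
    g * t * g⁻¹ ∈ Subgroup.closure T := by
  have : Subgroup.closure T ≤ (Subgroup.closure T).comap (MulAut.conj g).toMonoidHom :=
    (Subgroup.closure_le _).2 fun t ht => h t ht
  exact this ht

theorem mem_normalizer_closure {G : Type*} [Group G] {T : Set G} {g : G}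
    (h : ∀ t ∈ T, g * t * g⁻¹ ∈ Subgroup.closure T)
    (h' : ∀ t ∈ T, g⁻¹ * t * g ∈ Subgroup.closure T) :
    g ∈ Subgroup.normalizer (Subgroup.closure T : Set G) := by
  rw [Subgroup.mem_normalizer_iff]
  refine fun t => ⟨fun ht => conj_mem_closure h ht, fun ht => ?_⟩
  have := conj_mem_closure (g := g⁻¹) (by simpa using h') ht
  simpa [mul_assoc] using this

variable {n k : ℕ}

theorem inr_mem_rest_inl (i : Fin n) (j : Fin k) :
    of (Sum.inr j) ∈ rest (Sum.inl i : Fin n ⊕ Fin k) := of_mem_rest Sum.inr_ne_inl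

/-- The move `x_i ↦ u x_i`. -/
abbrev lmul (i : Fin n) (u : F n k) (hu : u ∈ rest (Sum.inl i)) : MulAut (F n k) :=
  mv (Sum.inl i) u 1 hu (one_mem _)

/-- The move `x_i ↦ x_i u`. -/
abbrev rmul (i : Fin n) (u : F n k) (hu : u ∈ rest (Sum.inl i)) : MulAut (F n k) :=
  mv (Sum.inl i) 1 u (one_mem _) hu

/-- The move `z ↦ u z u⁻¹`. -/
abbrev cmv (z : Fin n ⊕ Fin k) (u : F n k) (hu : u ∈ rest z) : MulAut (F n k) :=
  mv z u u⁻¹ hu (inv_mem hu)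

/-- The elements `u` such that the move `y_j ↦ u y_j u⁻¹` belongs to `G`. -/
def conjFactors (G : Subgroup (MulAut (F n k))) (j : Fin k) : Subgroup (F n k) where
  carrier := {u | ∃ hu : u ∈ rest (Sum.inr j), cmv (Sum.inr j) u hu ∈ G}
  one_mem' := ⟨one_mem _, by rw [cmv, mv_congr _ _ rfl inv_one, mv_one]; exact one_mem _⟩
  mul_mem' := by
    rintro u v ⟨hu, hGu⟩ ⟨hv, hGv⟩
    refine ⟨mul_mem hu hv, ?_⟩
    have := G.mul_mem hGv hGu
    rwa [mv_mul, mv_congr _ _ rfl (mul_inv_rev u v).symm] at this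
  inv_mem' := by
    rintro u ⟨hu, hGu⟩
    refine ⟨inv_mem hu, ?_⟩
    have := G.inv_mem hGu
    rwa [mv_inv] at this

/-- A subgroup with all moves `y_j ↦ z y_j z⁻¹` for basis elements `z` has them for all `z` in the
subgroup generated by the other basis elements. -/
theorem cmv_mem {G : Subgroup (MulAut (F n k))} {j : Fin k}
    (hG : ∀ z (hz : z ≠ Sum.inr j), conjMove (Sum.inr j) z hz ∈ G) {u : F n k}
    (hu : u ∈ rest (Sum.inr j)) : cmv (Sum.inr j) u hu ∈ G := by
  have : rest (Sum.inr j) ≤ conjFactors G j := by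
    refine (Subgroup.closure_le _).2 ?_
    rintro _ ⟨s, hs, rfl⟩
    exact ⟨of_mem_rest hs, hG s hs⟩
  exact (this hu).2

/-- The elements `u` such that the move `x_i ↦ u x_i` belongs to `G`. -/
def leftFactors (G : Subgroup (MulAut (F n k))) (i : Fin n) : Subgroup (F n k) where
  carrier := {u | ∃ hu : u ∈ rest (Sum.inl i), lmul i u hu ∈ G}
  one_mem' := ⟨one_mem _, by rw [lmul, mv_one]; exact one_mem _⟩
  mul_mem' := by
    rintro u v ⟨hu, hGu⟩ ⟨hv, hGv⟩
    refine ⟨mul_mem hu hv, ?_⟩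
    have := G.mul_mem hGv hGu
    rwa [mv_mul, mv_congr _ _ rfl (mul_one 1)] at this
  inv_mem' := by
    rintro u ⟨hu, hGu⟩
    refine ⟨inv_mem hu, ?_⟩
    have := G.inv_mem hGu
    rwa [mv_inv, mv_congr _ _ rfl inv_one] at this

/-- The elements `u` such that the move `x_i ↦ x_i u` belongs to `G`. -/
def rightFactors (G : Subgroup (MulAut (F n k))) (i : Fin n) : Subgroup (F n k) where
  carrier := {u | ∃ hu : u ∈ rest (Sum.inl i), rmul i u hu ∈ G}
  one_mem' := ⟨one_mem _, by rw [rmul, mv_one]; exact one_mem _⟩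
  mul_mem' := by
    rintro u v ⟨hu, hGu⟩ ⟨hv, hGv⟩
    refine ⟨mul_mem hu hv, ?_⟩
    have := G.mul_mem hGu hGv
    rwa [mv_mul, mv_congr _ _ (mul_one 1) rfl] at this
  inv_mem' := by
    rintro u ⟨hu, hGu⟩
    refine ⟨inv_mem hu, ?_⟩
    have := G.inv_mem hGu
    rwa [mv_inv, mv_congr _ _ inv_one rfl] at this

theorem conj_mem_leftFactors {G : Subgroup (MulAut (F n k))} {i : Fin n} {g : MulAut (F n k)}
    (hg : g ∈ G) (hz : g (of (Sum.inl i)) = of (Sum.inl i))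
    (hrest : ∀ s, s ≠ Sum.inl i → g (of s) ∈ rest (Sum.inl i)) {u : F n k}
    (hu : u ∈ leftFactors G i) : g u ∈ leftFactors G i := by
  obtain ⟨hu, hGu⟩ := hu
  have hgu : g u ∈ rest (Sum.inl i) := by
    have : rest (Sum.inl i) ≤ (rest (Sum.inl i)).comap g.toMonoidHom := by
      refine (Subgroup.closure_le _).2 ?_
      rintro _ ⟨s, hs, rfl⟩
      exact hrest s hs
    exact this hu
  refine ⟨hgu, ?_⟩
  have := G.mul_mem (G.mul_mem hg hGu) (G.inv_mem hg)
  rw [conj_mv _ _ hz hrest hgu (by rw [map_one]; exact one_mem _)] at this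
  rwa [mv_congr _ _ rfl (map_one g)] at this

/-- The moves `x_i ↦ y_j x_i`, `x_i ↦ x_i y_j` and `y_j ↦ z y_j z⁻¹`. -/
def kernelMoves (n k : ℕ) : Set (MulAut (F n k)) :=
  {f | (∃ i j, f = lmul i (of (Sum.inr j)) (inr_mem_rest_inl i j)) ∨
    (∃ i j, f = rmul i (of (Sum.inr j)) (inr_mem_rest_inl i j)) ∨
    ∃ j z, ∃ hz : z ≠ Sum.inr j, f = conjMove (Sum.inr j) z hz}

/-- Automorphisms that permute the `x_i` up to inversion and fix every `y_j`. -/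
def signedPerms (n k : ℕ) : Set (MulAut (F n k)) :=
  {g | ∃ (σ : Equiv.Perm (Fin n ⊕ Fin k)) (ε : Fin n ⊕ Fin k → Bool),
    (∀ z, g (of z) = mk [(σ z, ε z)]) ∧ ∀ j, σ (Sum.inr j) = Sum.inr j ∧ ε (Sum.inr j) = true}

/-- The moves `x_a ↦ x_b x_a`. -/
def nielsenMoves (n k : ℕ) : Set (MulAut (F n k)) :=
  {g | ∃ (a b : Fin n) (h : b ≠ a), g = lmul a (of (Sum.inl b)) (of_mem_rest (by simpa using h))}

theorem inv_mem_signedPerms {g : MulAut (F n k)} (hg : g ∈ signedPerms n k) :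
    g⁻¹ ∈ signedPerms n k := by
  obtain ⟨σ, ε, h1, h2⟩ := hg
  refine ⟨σ⁻¹, fun z => ε (σ⁻¹ z), fun z => ?_, fun j => ?_⟩
  · change g.symm _ = _
    rw [MulEquiv.symm_apply_eq]
    dsimp only
    have h3 := h1 (σ⁻¹ z)
    rw [← Equiv.Perm.mul_apply, mul_inv_cancel, Equiv.Perm.one_apply] at h3
    cases h : ε (σ⁻¹ z) <;> rw [h] at h3
    · have : mk [(σ⁻¹ z, false)] = (of (σ⁻¹ z))⁻¹ := rfl
      rw [this, map_inv, h3]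
      simp [invRev, of]
    · exact h3.symm
  · have : σ⁻¹ (Sum.inr j) = Sum.inr j := by rw [Equiv.Perm.inv_eq_iff_eq, (h2 j).1]
    simp [this, (h2 j).2]

theorem inversion_mem_signedPerms (a : Fin n) :
    inversion (Sum.inl a) ∈ signedPerms n k := by
  refine ⟨1, fun s => !decide (s = Sum.inl a), fun z => ?_, fun j => by simp⟩
  by_cases hz : z = Sum.inl a
  · subst hz
    rw [inversion_of_self]
    simp [of, invRev]
  · rw [inversion_of_ne hz]
    simp [of, hz]

end Subgroups

/-! ### The kernel moves are normalized by automorphisms of `F_n` -/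

section Normalizer

open FreeGroup hiding map_inv map_mul map_one

variable {n k : ℕ}

/-- The subgroup generated by the moves `x_i ↦ y_j x_i`, `x_i ↦ x_i y_j` and `y_j ↦ z y_j z⁻¹`. -/
def kernelGroup (n k : ℕ) : Subgroup (MulAut (F n k)) := Subgroup.closure (kernelMoves n k)

/-- The copy of `Aut(F_n)` in `Aut(F_{n,k})` generated by signed permutations of the `x_i` and
the moves `x_a ↦ x_b x_a`. -/
def nielsenGroup (n k : ℕ) : Subgroup (MulAut (F n k)) :=
  Subgroup.closure (signedPerms n k ∪ nielsenMoves n k)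

theorem conjMove_mem_kernelGroup (j : Fin k) (z : Fin n ⊕ Fin k) (hz : z ≠ Sum.inr j) :
    conjMove (Sum.inr j) z hz ∈ kernelGroup n k :=
  Subgroup.subset_closure (Or.inr (Or.inr ⟨j, z, hz, rfl⟩))

theorem cmv_mem_kernelGroup {j : Fin k} {u : F n k} (hu : u ∈ rest (Sum.inr j)) :
    cmv (Sum.inr j) u hu ∈ kernelGroup n k :=
  cmv_mem (conjMove_mem_kernelGroup j) hu

theorem inr_mem_leftFactors (i : Fin n) (j : Fin k) :
    of (Sum.inr j) ∈ leftFactors (kernelGroup n k) i :=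
  ⟨inr_mem_rest_inl i j, Subgroup.subset_closure (Or.inl ⟨i, j, rfl⟩)⟩

theorem inr_mem_rightFactors (i : Fin n) (j : Fin k) :
    of (Sum.inr j) ∈ rightFactors (kernelGroup n k) i :=
  ⟨inr_mem_rest_inl i j, Subgroup.subset_closure (Or.inr (Or.inl ⟨i, j, rfl⟩))⟩

/-- Any automorphism that fixes `y_j` and preserves the subgroup generated by the other basis
elements conjugates the moves `y_j ↦ z y_j z⁻¹` into the kernel group. -/
theorem conj_conjMove_mem_kernelGroup {g : MulAut (F n k)} {j : Fin k}
    (hg : g (of (Sum.inr j)) = of (Sum.inr j))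
    (hrest : ∀ s, s ≠ Sum.inr j → g (of s) ∈ rest (Sum.inr j)) (z : Fin n ⊕ Fin k)
    (hz : z ≠ Sum.inr j) : g * conjMove (Sum.inr j) z hz * g⁻¹ ∈ kernelGroup n k := by
  have h : g * cmv (Sum.inr j) (of z) (of_mem_rest hz) * g⁻¹ = cmv (Sum.inr j) (g (of z))
      (hrest z hz) := by
    rw [conj_mv _ _ hg hrest (hrest z hz) (by rw [map_inv]; exact inv_mem (hrest z hz)),
      mv_congr _ _ rfl (map_inv g (of z))]
  exact h ▸ cmv_mem_kernelGroup (hrest z hz)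

theorem conj_mem_kernelGroup_of_signedPerm {g : MulAut (F n k)} (hg : g ∈ signedPerms n k)
    {t : MulAut (F n k)} (ht : t ∈ kernelMoves n k) : g * t * g⁻¹ ∈ kernelGroup n k := by
  obtain ⟨σ, ε, h1, h2⟩ := hg
  have hy : ∀ j, g (of (Sum.inr j)) = of (Sum.inr j) := by
    intro j
    rw [h1, (h2 j).1, (h2 j).2, of]
  have hx : ∀ i, ∃ i', σ (Sum.inl i) = Sum.inl i' := by
    intro i
    rcases h : σ (Sum.inl i) with i' | j
    · exact ⟨i', rfl⟩
    · rw [← (h2 j).1] at h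
      simpa using σ.injective h
  have key : ∀ i i' u u' v v' (hu : u ∈ rest (Sum.inl i)) (hu' : u' ∈ rest (Sum.inl i))
      (hv : v ∈ rest (Sum.inl i')) (hv' : v' ∈ rest (Sum.inl i')), σ (Sum.inl i) = Sum.inl i' →
      g (u * of (Sum.inl i) * u') = mv (Sum.inl i') v v' hv hv' (g (of (Sum.inl i))) →
      g * mv (Sum.inl i) u u' hu hu' * g⁻¹ = mv (Sum.inl i') v v' hv hv' := by
    intro i i' u u' v v' hu hu' hv hv' hi h
    refine conj_eq_of_forall fun s => ?_
    by_cases hs : s = Sum.inl i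
    · subst hs
      rw [mv_of_self, h]
    · rw [mv_of_ne _ _ hs, h1, mv_of_mem_rest _ _
        (mk_mem_rest (fun h => hs (σ.injective (h.trans hi.symm))) _)]
  -- An inversion of `x_i` exchanges left and right multiplication.
  rcases ht with ⟨i, j, rfl⟩ | ⟨i, j, rfl⟩ | ⟨j, z, hz, rfl⟩
  · obtain ⟨i', hi⟩ := hx i
    have hg1 := h1 (Sum.inl i)
    rw [hi] at hg1
    cases he : ε (Sum.inl i) <;> rw [he] at hg1
    · have hg1 : g (of (Sum.inl i)) = (of (Sum.inl i'))⁻¹ := hg1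
      obtain ⟨h3, h4⟩ := inv_mem (inr_mem_rightFactors (n := n) i' j)
      rwa [key i i' _ _ 1 (of (Sum.inr j))⁻¹ _ _ (one_mem _) h3 hi (by simp [hg1, hy])]
    · have hg1 : g (of (Sum.inl i)) = of (Sum.inl i') := hg1
      obtain ⟨h3, h4⟩ := inr_mem_leftFactors (n := n) i' j
      rwa [key i i' _ _ (of (Sum.inr j)) 1 _ _ h3 (one_mem _) hi (by simp [hg1, hy])]
  · obtain ⟨i', hi⟩ := hx i
    have hg1 := h1 (Sum.inl i)
    rw [hi] at hg1
    cases he : ε (Sum.inl i) <;> rw [he] at hg1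
    · have hg1 : g (of (Sum.inl i)) = (of (Sum.inl i'))⁻¹ := hg1
      obtain ⟨h3, h4⟩ := inv_mem (inr_mem_leftFactors (n := n) i' j)
      rwa [key i i' _ _ (of (Sum.inr j))⁻¹ 1 _ _ h3 (one_mem _) hi (by simp [hg1, hy])]
    · have hg1 : g (of (Sum.inl i)) = of (Sum.inl i') := hg1
      obtain ⟨h3, h4⟩ := inr_mem_rightFactors (n := n) i' j
      rwa [key i i' _ _ 1 (of (Sum.inr j)) _ _ (one_mem _) h3 hi (by simp [hg1, hy])]
  · refine conj_conjMove_mem_kernelGroup (hy j) (fun s hs => ?_) z hz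
    rw [h1]
    exact mk_mem_rest (fun h => hs (σ.injective (h.trans (h2 j).1.symm))) _

theorem conj_mem_leftFactors_kernelGroup {i : Fin n} {j : Fin k} {u : F n k}
    (hi : u ∈ rest (Sum.inl i)) (hj : u ∈ rest (Sum.inr j)) :
    u * of (Sum.inr j) * u⁻¹ ∈ leftFactors (kernelGroup n k) i := by
  have h := conj_mem_leftFactors (cmv_mem_kernelGroup hj) (mv_of_ne _ _ Sum.inl_ne_inr) ?_
    (inr_mem_leftFactors i j)
  · rwa [mv_of_self] at h
  · intro s hs
    by_cases h : s = Sum.inr j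
    · subst h
      rw [mv_of_self]
      exact mul_mem (mul_mem hi (of_mem_rest hs)) (inv_mem hi)
    · rw [mv_of_ne _ _ h]
      exact of_mem_rest hs

theorem conj_mem_kernelGroup_of_nielsenMove {g : MulAut (F n k)} (hg : g ∈ nielsenMoves n k)
    {t : MulAut (F n k)} (ht : t ∈ kernelMoves n k) : g * t * g⁻¹ ∈ kernelGroup n k := by
  obtain ⟨a, b, hab, rfl⟩ := hg
  have hab' : (Sum.inl b : Fin n ⊕ Fin k) ≠ Sum.inl a := by simpa using hab
  rcases ht with ⟨i, j, rfl⟩ | ⟨i, j, rfl⟩ | ⟨j, z, hz, rfl⟩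
  · by_cases hi : i = b
    · -- `x_b ↦ y x_b` becomes `x_a ↦ (x_b⁻¹ y⁻¹ x_b) x_a`, `x_b ↦ y x_b`.
      subst hi
      obtain ⟨h3, h4⟩ := inv_mem (conj_mem_leftFactors_kernelGroup (j := j)
        (inv_mem (of_mem_rest hab')) (inv_mem (of_mem_rest Sum.inl_ne_inr)))
      obtain ⟨h5, h6⟩ := inr_mem_leftFactors (n := n) i j
      convert mul_mem h6 h4 using 1
      refine conj_eq_of_forall fun s => ?_
      rw [MulAut.mul_apply]
      by_cases hs : s = Sum.inl a
      · subst hs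
        simp [mv_of_ne, hab', hab'.symm, mul_assoc]
      · by_cases hs' : s = Sum.inl i
        · subst hs'
          simp [mv_of_ne, hab']
        · simp [mv_of_ne, hs, hs']
    · have hib : (Sum.inl b : Fin n ⊕ Fin k) ≠ Sum.inl i := by simpa using Ne.symm hi
      by_cases hi' : i = a
      · subst hi'
        obtain ⟨h3, h4⟩ := conj_mem_leftFactors_kernelGroup (j := j)
          (inv_mem (of_mem_rest hab')) (inv_mem (of_mem_rest Sum.inl_ne_inr))
        convert h4 using 1
        refine conj_eq_of_forall fun s => ?_
        by_cases hs : s = Sum.inl i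
        · subst hs
          simp [mv_of_ne, hab', mul_assoc]
        · simp [mv_of_ne, hs]
      · have hia : (Sum.inl a : Fin n ⊕ Fin k) ≠ Sum.inl i := by simpa using Ne.symm hi'
        obtain ⟨h3, h4⟩ := inr_mem_leftFactors (n := n) i j
        convert h4 using 1
        refine conj_eq_of_forall fun s => ?_
        by_cases hs : s = Sum.inl i
        · subst hs
          simp [mv_of_ne, hia.symm]
        · by_cases hs' : s = Sum.inl a
          · subst hs'
            simp [mv_of_ne, hib, hia]
          · simp [mv_of_ne, hs, hs']
  · by_cases hi : i = b
    · -- `x_b ↦ x_b y` becomes `x_a ↦ y⁻¹ x_a`, `x_b ↦ x_b y`.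
      subst hi
      obtain ⟨h3, h4⟩ := inv_mem (inr_mem_leftFactors (n := n) a j)
      obtain ⟨h5, h6⟩ := inr_mem_rightFactors (n := n) i j
      convert mul_mem h6 h4 using 1
      refine conj_eq_of_forall fun s => ?_
      rw [MulAut.mul_apply]
      by_cases hs : s = Sum.inl a
      · subst hs
        simp [mv_of_ne, hab', hab'.symm, mul_assoc]
      · by_cases hs' : s = Sum.inl i
        · subst hs'
          simp [mv_of_ne, hab']
        · simp [mv_of_ne, hs, hs']
    · have hib : (Sum.inl b : Fin n ⊕ Fin k) ≠ Sum.inl i := by simpa using Ne.symm hi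
      obtain ⟨h3, h4⟩ := inr_mem_rightFactors (n := n) i j
      convert h4 using 1
      refine conj_eq_of_forall fun s => ?_
      by_cases hi' : i = a
      · subst hi'
        by_cases hs : s = Sum.inl i
        · subst hs
          simp [mv_of_ne, hab', mul_assoc]
        · simp [mv_of_ne, hs]
      · have hia : (Sum.inl a : Fin n ⊕ Fin k) ≠ Sum.inl i := by simpa using Ne.symm hi'
        by_cases hs : s = Sum.inl i
        · subst hs
          simp [mv_of_ne, hia.symm]
        · by_cases hs' : s = Sum.inl a
          · subst hs'
            simp [mv_of_ne, hib, hia]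
          · simp [mv_of_ne, hs, hs']
  · refine conj_conjMove_mem_kernelGroup (mv_of_ne _ _ Sum.inr_ne_inl) (fun s hs => ?_) z hz
    by_cases h : s = Sum.inl a
    · subst h
      rw [mv_of_self]
      exact mul_mem (mul_mem (of_mem_rest Sum.inl_ne_inr) (of_mem_rest hs)) (one_mem _)
    · rw [mv_of_ne _ _ h]
      exact of_mem_rest hs

theorem inv_nielsenMove {a b : Fin n} (h : b ≠ a) :
    (lmul a (of (Sum.inl b)) (of_mem_rest (by simpa using h)) : MulAut (F n k))⁻¹ =
      inversion (Sum.inl b) * lmul a (of (Sum.inl b)) (of_mem_rest (by simpa using h)) *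
        (inversion (Sum.inl b))⁻¹ := by
  have hab : (Sum.inl a : Fin n ⊕ Fin k) ≠ Sum.inl b := by simpa using Ne.symm h
  symm
  rw [mv_inv]
  refine conj_eq_of_forall fun s => ?_
  by_cases hs : s = Sum.inl a
  · subst hs
    simp [inversion_of_ne, inversion_of_self, hab]
  · by_cases hs' : s = Sum.inl b
    · subst hs'
      simp [inversion_of_self, mv_of_ne, hs]
    · simp [inversion_of_ne, mv_of_ne, hs, hs']

theorem nielsenGroup_le_normalizer :
    nielsenGroup n k ≤ Subgroup.normalizer (kernelGroup n k : Set (MulAut (F n k))) := by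
  have hσ : ∀ g ∈ signedPerms n k,
      g ∈ Subgroup.normalizer (kernelGroup n k : Set (MulAut (F n k))) := by
    intro g hg
    refine mem_normalizer_closure (fun t ht => conj_mem_kernelGroup_of_signedPerm hg ht)
      fun t ht => ?_
    have := conj_mem_kernelGroup_of_signedPerm (inv_mem_signedPerms hg) ht
    rwa [inv_inv] at this
  refine (Subgroup.closure_le _).2 ?_
  rintro g (hg | hg)
  · exact hσ g hg
  · refine mem_normalizer_closure (fun t ht => conj_mem_kernelGroup_of_nielsenMove hg ht)
      fun t ht => ?_
    obtain ⟨a, b, hab, rfl⟩ := id hg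
    have hι := hσ _ (inversion_mem_signedPerms (n := n) (k := k) b)
    rw [Subgroup.mem_normalizer_iff] at hι
    have h1 := conj_mem_kernelGroup_of_signedPerm (inversion_mem_signedPerms b) ht
    have h2 := conj_mem_closure (fun t ht => conj_mem_kernelGroup_of_nielsenMove hg ht) h1
    have h3 := (hι _).1 h2
    have e := inv_nielsenMove (k := k) hab
    generalize (lmul a (of (Sum.inl b)) _ : MulAut (F n k)) = τ at e h3 ⊢
    have h4 : τ⁻¹ * t * τ = τ⁻¹ * t * (τ⁻¹)⁻¹ := by rw [inv_inv]
    rw [h4, e]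
    change _ ∈ kernelGroup n k
    simpa only [mul_inv_rev, inv_inv, mul_assoc, inversion_inv] using h3

/-- Every element of `kernelGroup ⊔ nielsenGroup` is a product of an element of the first group
and one of the second. -/
theorem exists_mul_of_mem_sup {f : MulAut (F n k)} (hf : f ∈ kernelGroup n k ⊔ nielsenGroup n k) :
    ∃ ν ∈ kernelGroup n k, ∃ γ ∈ nielsenGroup n k, f = ν * γ := by
  rw [sup_comm, ← SetLike.mem_coe,
    Subgroup.coe_mul_of_left_le_normalizer_right _ _ nielsenGroup_le_normalizer,
    Subgroup.set_mul_normalizer_comm _ _ nielsenGroup_le_normalizer] at hf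
  obtain ⟨ν, hν, γ, hγ, rfl⟩ := hf
  exact ⟨ν, hν, γ, hγ, rfl⟩

end Normalizer

/-! ### Generators of the group of automorphisms preserving the conjugacy classes of the `y_j` -/

section Generation

open FreeGroup hiding map_inv map_mul map_one

section

variable {ι κ : Type*} [DecidableEq ι] [DecidableEq κ]

/-- Every conjugate of a letter `t` is of the form `w t w⁻¹` without cancellation. -/
theorem exists_isReducedConj (t : (ι ⊕ κ) × Bool) (c : FreeGroup (ι ⊕ κ)) :
    ∃ w, IsReducedConj (c * mk [t] * c⁻¹) t w := by
  induction hm : c.norm using Nat.strong_induction_on generalizing c with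
  | _ m ih =>
    subst hm
    obtain ⟨L, hL⟩ : ∃ L, L = c.toWord := ⟨_, rfl⟩
    have hc : c = mk L := by rw [hL, mk_toWord]
    have hred : IsReduced L := hL ▸ isReduced_toWord
    have hn : c.norm = L.length := by rw [hL, FreeGroup.norm]
    rcases List.eq_nil_or_concat' L with h | ⟨L', d, h⟩
    · have : c = 1 := by rw [hc, h, one_eq_mk]
      exact ⟨1, by rw [this], by
        rw [this, one_mul, inv_one, mul_one, norm_mk_singleton, FreeGroup.norm_one]⟩
    · by_cases hd : d.1 = t.1
      · -- The last letter of `c` commutes with `t` and can be dropped.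
        have hcomm : mk [d] * mk [t] * (mk [d])⁻¹ = mk [t] := by
          have : d = t ∨ d = flip t := by
            obtain ⟨d, e⟩ := d
            obtain ⟨t, e'⟩ := t
            subst hd
            cases e <;> cases e' <;> simp [flip]
          rcases this with rfl | rfl
          · group
          · rw [mk_flip]; group
        have hc' : c * mk [t] * c⁻¹ = mk L' * mk [t] * (mk L')⁻¹ := by
          have : c = mk L' * mk [d] := by rw [hc, h, mul_mk]
          rw [this]
          nth_rewrite 2 [← hcomm]
          group
        rw [hc']
        refine ih _ ?_ _ rfl
        have : (mk L').norm ≤ L'.length := norm_mk_le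
        rw [hn, h, List.length_append, List.length_singleton]
        omega
      · have hinv : IsReduced (invRev L) := by
          rw [isReduced_iff_reduce_eq, reduce_invRev, hred.reduce_eq]
        have h1 : IsReduced (L ++ [t]) := by
          refine List.IsChain.append hred (by simp) ?_
          intro a ha b hb hab
          rw [h, List.getLast?_concat, Option.mem_some_iff] at ha
          rw [List.head?_cons, Option.mem_some_iff] at hb
          subst ha hb
          exact absurd hab hd
        have h2 : IsReduced (L ++ [t] ++ invRev L) := by
          refine List.IsChain.append h1 hinv ?_
          intro a ha b hb hab
          rw [List.getLast?_concat, Option.mem_some_iff] at ha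
          subst ha
          simp only [h, invRev, List.map_append, List.map_cons, List.map_nil, List.reverse_append,
            List.reverse_cons, List.reverse_nil, List.nil_append, List.cons_append,
            List.head?_cons, Option.mem_def, Option.some.injEq] at hb
          subst hb
          exact absurd hab.symm hd
        refine ⟨c, rfl, ?_⟩
        have h3 : c * mk [t] * c⁻¹ = mk (L ++ [t] ++ invRev L) := by
          rw [hc, inv_mk, mul_mk, mul_mk]
        rw [h3, hn, FreeGroup.norm, toWord_mk, h2.reduce_eq]
        simp only [List.length_append, invRev_length, List.length_singleton]
        omega

end

variable {n k : ℕ}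

theorem exists_isReducedConj_of_mem_autFB {f : MulAut (F n k)} (hf : f ∈ autFB n k) (j : Fin k)
    (e : Bool) : ∃ w, IsReducedConj (f (mk [(Sum.inr j, e)])) (Sum.inr j, e) w := by
  obtain ⟨c, hc⟩ := isConj_iff.1 (hf j).symm
  have hc : c * mk [(Sum.inr j, true)] * c⁻¹ = f (mk [(Sum.inr j, true)]) := hc
  obtain ⟨w, hw⟩ := exists_isReducedConj (Sum.inr j, true) c
  rw [hc] at hw
  refine ⟨w, ?_⟩
  cases e
  · have := hw.inv
    rwa [← map_inv, ← mk_flip] at this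
  · exact hw

theorem kernelMoves_subset_autFB : kernelMoves n k ⊆ autFB n k := by
  rintro f (⟨i, j, rfl⟩ | ⟨i, j, rfl⟩ | ⟨j, z, hz, rfl⟩) j'
  · rw [y, mv_of_ne _ _ Sum.inr_ne_inl]
  · rw [y, mv_of_ne _ _ Sum.inr_ne_inl]
  · change IsConj (cmv (Sum.inr j) (of z) (of_mem_rest hz) (of (Sum.inr j'))) _
    by_cases h : j' = j
    · subst h
      rw [mv_of_self]
      exact (isConj_iff.2 ⟨of z, rfl⟩).symm
    · rw [mv_of_ne _ _ (by simpa using h)]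
      exact IsConj.refl _

theorem nielsenGenerators_subset_autFB :
    signedPerms n k ∪ nielsenMoves n k ⊆ (autFB n k : Set (MulAut (F n k))) := by
  rintro f (⟨σ, ε, h1, h2⟩ | ⟨a, b, hab, rfl⟩) j
  · rw [y, h1, (h2 j).1, (h2 j).2]
    exact IsConj.refl _
  · rw [y, mv_of_ne _ _ Sum.inr_ne_inl]

theorem sup_le_autFB : kernelGroup n k ⊔ nielsenGroup n k ≤ autFB n k :=
  sup_le ((Subgroup.closure_le _).2 kernelMoves_subset_autFB)
    ((Subgroup.closure_le _).2 nielsenGenerators_subset_autFB)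

theorem rest_le_leftFactors_sup (i : Fin n) :
    rest (Sum.inl i) ≤ leftFactors (kernelGroup n k ⊔ nielsenGroup n k) i := by
  refine (Subgroup.closure_le _).2 ?_
  rintro _ ⟨b | j, hs, rfl⟩
  · refine ⟨of_mem_rest hs, ?_⟩
    exact (le_sup_right : nielsenGroup n k ≤ _)
      (Subgroup.subset_closure (Or.inr ⟨i, b, by simpa using hs, rfl⟩))
  · obtain ⟨h1, h2⟩ := inr_mem_leftFactors i j
    exact ⟨h1, (le_sup_left : kernelGroup n k ≤ _) h2⟩

theorem rest_le_rightFactors_sup (i : Fin n) :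
    rest (Sum.inl i) ≤ rightFactors (kernelGroup n k ⊔ nielsenGroup n k) i := by
  refine (Subgroup.closure_le _).2 ?_
  rintro _ ⟨b | j, hs, rfl⟩
  · have hs' : b ≠ i := by simpa using hs
    have h1 : lmul i (of (Sum.inl b)) (of_mem_rest hs) ∈ nielsenGroup n k :=
      Subgroup.subset_closure (Or.inr ⟨i, b, hs', rfl⟩)
    have h2 : inversion (Sum.inl i) ∈ nielsenGroup n k :=
      Subgroup.subset_closure (Or.inl (inversion_mem_signedPerms i))
    refine ⟨of_mem_rest hs, (le_sup_right : nielsenGroup n k ≤ _) ?_⟩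
    convert mul_mem (mul_mem h2 (inv_mem h1)) (inv_mem h2) using 1
    symm
    rw [mv_inv]
    refine conj_eq_of_forall fun s => ?_
    by_cases h : s = Sum.inl i
    · subst h
      have hs'' : (Sum.inl b : Fin n ⊕ Fin k) ≠ Sum.inl i := hs
      simp [inversion_of_self, inversion_of_ne, hs'']
    · simp [inversion_of_ne, mv_of_ne, h]
  · obtain ⟨h1, h2⟩ := inr_mem_rightFactors i j
    exact ⟨h1, (le_sup_left : kernelGroup n k ≤ _) h2⟩

/-- Every elementary move of a locally minimal family is realized by an automorphism. -/
theorem exists_moved {s t : (Fin n ⊕ Fin k) × Bool} (hst : s.1 ≠ t.1) :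
    ∃ e ∈ kernelGroup n k ⊔ nielsenGroup n k, (∀ z, z ≠ t.1 → e (of z) = of z) ∧
      ∀ f : MulAut (F n k), f (e (mk [t])) = moved f.toMonoidHom s t := by
  obtain ⟨i | j, b⟩ := t
  · have hs : (mk [s])⁻¹ ∈ rest (Sum.inl i) := inv_mem (mk_mem_rest hst s.2)
    cases b
    · obtain ⟨h1, h2⟩ := rest_le_rightFactors_sup i (mk_mem_rest hst s.2)
      refine ⟨_, h2, fun z hz => mv_of_ne _ _ hz, fun f => ?_⟩
      have : (mk [(Sum.inl i, false)] : F n k) = (of (Sum.inl i))⁻¹ := rfl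
      change _ = (f (mk [s]))⁻¹ * f (mk [(Sum.inl i, false)])
      rw [this, map_inv, mv_of_self]
      simp [-inv_mk]
    · obtain ⟨h1, h2⟩ := rest_le_leftFactors_sup i hs
      refine ⟨_, h2, fun z hz => mv_of_ne _ _ hz, fun f => ?_⟩
      have : (mk [(Sum.inl i, true)] : F n k) = of (Sum.inl i) := rfl
      change _ = (f (mk [s]))⁻¹ * f (mk [(Sum.inl i, true)])
      rw [this, mv_of_self]
      simp [-inv_mk]
  · have hs : (mk [s])⁻¹ ∈ rest (Sum.inr j) := inv_mem (mk_mem_rest hst s.2)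
    refine ⟨cmv (Sum.inr j) (mk [s])⁻¹ hs, (le_sup_left : kernelGroup n k ≤ _)
      (cmv_mem_kernelGroup hs), fun z hz => mv_of_ne _ _ hz, fun f => ?_⟩
    change _ = (f (mk [s]))⁻¹ * f (mk [(Sum.inr j, b)]) * f (mk [s])
    cases b
    · have : (mk [(Sum.inr j, false)] : F n k) = (of (Sum.inr j))⁻¹ := rfl
      rw [this, map_inv, mv_of_self]
      simp [-inv_mk, mul_assoc]
    · have : (mk [(Sum.inr j, true)] : F n k) = of (Sum.inr j) := rfl
      rw [this, mv_of_self]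
      simp [-inv_mk]

theorem norm_map_mk (f : MulAut (F n k)) (t : (Fin n ⊕ Fin k) × Bool) :
    (f (mk [t])).norm = (f (of t.1)).norm := by
  obtain ⟨t, _ | _⟩ := t
  · have : (mk [(t, false)] : F n k) = (of t)⁻¹ := rfl
    rw [this, map_inv, norm_inv_eq]
  · rfl

theorem weight_map_mk (code : List ((Fin n ⊕ Fin k) × Bool) → ℕ) (f : MulAut (F n k))
    (t : (Fin n ⊕ Fin k) × Bool) : weight code (f (mk [t])) = weight code (f (of t.1)) := by
  obtain ⟨t, _ | _⟩ := t
  · have : (mk [(t, false)] : F n k) = (of t)⁻¹ := rfl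
    rw [this, map_inv, weight_inv]
  · rfl

/-- A coset contains a locally minimal element: minimize the pair of total length and total
weight of the images of the basis lexicographically. -/
theorem exists_locallyMinimal (code : List ((Fin n ⊕ Fin k) × Bool) → ℕ) (f : MulAut (F n k)) :
    ∃ e ∈ kernelGroup n k ⊔ nielsenGroup n k, LocallyMinimal code (f * e).toMonoidHom := by
  let μ : MulAut (F n k) → ℕ ×ₗ ℕ := fun g =>
    toLex (∑ z, (g (of z)).norm, ∑ z, weight code (g (of z)))
  obtain ⟨_, ⟨e, he, rfl⟩, hmin⟩ := (wellFounded_lt : WellFounded ((· < ·) : ℕ ×ₗ ℕ → _)).has_min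
    ((fun e => μ (f * e)) '' (kernelGroup n k ⊔ nielsenGroup n k : Subgroup (MulAut (F n k))))
    ⟨_, 1, one_mem _, rfl⟩
  refine ⟨e, he, fun s t hst => ?_⟩
  obtain ⟨e', he', hfix, hmv⟩ := exists_moved hst
  have h1 := hmin _ ⟨e * e', mul_mem he he', rfl⟩
  rw [← hmv (f * e)]
  change ((f * e) (mk [t])).norm ≤ ((f * e * e') (mk [t])).norm ∧
    (((f * e) (mk [t])).norm = ((f * e * e') (mk [t])).norm →
      weight code ((f * e) (mk [t])) ≤ weight code ((f * e * e') (mk [t])))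
  rw [norm_map_mk, norm_map_mk, weight_map_mk, weight_map_mk]
  have hz : ∀ z, z ≠ t.1 → (f * e * e') (of z) = (f * e) (of z) := by
    intro z hz
    rw [MulAut.mul_apply _ (f * e), hfix z hz]
  simp only [μ, ← mul_assoc] at h1
  rw [Prod.Lex.toLex_lt_toLex] at h1
  push Not at h1
  generalize f * e * e' = g' at h1 hz ⊢
  generalize f * e = g at h1 hz ⊢
  constructor
  · by_contra! hlt
    refine absurd h1.1 (not_le.2 (Finset.sum_lt_sum (fun z _ => ?_) ⟨t.1, Finset.mem_univ _, hlt⟩))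
    by_cases h : z = t.1
    · subst h; exact hlt.le
    · rw [hz z h]
  · intro heq
    by_contra! hlt
    have hsum : ∑ z, (g' (of z)).norm = ∑ z, (g (of z)).norm := by
      refine Finset.sum_congr rfl fun z _ => ?_
      by_cases h : z = t.1
      · subst h; exact heq.symm
      · rw [hz z h]
    refine absurd (h1.2 hsum)
      (not_le.2 (Finset.sum_lt_sum (fun z _ => ?_) ⟨t.1, Finset.mem_univ _, hlt⟩))
    by_cases h : z = t.1
    · subst h; exact hlt.le
    · rw [hz z h]

theorem mem_signedPerms_of_norm_eq_one {h : MulAut (F n k)} (hh : h ∈ autFB n k)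
    (hnorm : ∀ z, (h (of z)).norm = 1) : h ∈ signedPerms n k := by
  have hs : ∀ z, ∃ s, h (of z) = mk [s] := by
    intro z
    obtain ⟨s, hs⟩ := List.length_eq_one_iff.1 (hnorm z)
    exact ⟨s, by rw [← hs, mk_toWord]⟩
  choose s hs using hs
  have hinj : Function.Injective fun z => (s z).1 := by
    intro z z' hzz
    have : s z = s z' ∨ s z = flip (s z') := by
      have hzz : (s z).1 = (s z').1 := hzz
      rcases h1 : s z with ⟨a, e⟩
      rcases h2 : s z' with ⟨b, e'⟩
      cases e <;> cases e' <;> simp_all [flip]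
    rcases this with h1 | h1
    · have h2 : h (of z) = h (of z') := by rw [hs, hs, h1]
      exact of_injective (h.injective h2)
    · have h2 : h (of z) = h (of z')⁻¹ := by rw [map_inv, hs, hs, h1, mk_flip]
      have h3 := congrArg FreeGroup.toWord (h.injective h2)
      simp [invRev] at h3
  refine ⟨Equiv.ofBijective _ (Finite.injective_iff_bijective.1 hinj), fun z => (s z).2, hs, ?_⟩
  intro j
  -- Conjugate letters are equal, because they have the same exponents.
  let χ : F n k →* Multiplicative ℤ :=
    lift fun z => if z = Sum.inr j then Multiplicative.ofAdd 1 else 1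
  obtain ⟨c, hc⟩ := isConj_iff.1 (hh j)
  have h1 := congrArg χ hc
  have h2 : h (y j) = mk [s (Sum.inr j)] := hs _
  rw [h2, map_mul, map_mul, map_inv, mul_comm, inv_mul_cancel_left] at h1
  change (s (Sum.inr j)).1 = _ ∧ (s (Sum.inr j)).2 = _
  rcases h3 : s (Sum.inr j) with ⟨a, e⟩
  rw [h3] at h1
  have h4 : χ (y j) = Multiplicative.ofAdd 1 := by simp [χ, y]
  rw [h4] at h1
  have h5 : (Multiplicative.ofAdd (1 : ℤ)) ≠ 1 := by decide
  have h6 : (Multiplicative.ofAdd (1 : ℤ))⁻¹ ≠ Multiplicative.ofAdd 1 := by decide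
  by_cases ha : a = Sum.inr j
  · subst ha
    cases e
    · simp [χ] at h1
      exact absurd h1 h6
    · exact ⟨rfl, rfl⟩
  · cases e <;> simp [χ, ha] at h1 <;> exact absurd h1.symm h5

/-- The group of all automorphisms that preserve the conjugacy classes of the `y_j` is generated by
the kernel moves and Nielsen's generators of `Aut(F_n)`. -/
theorem sup_eq_autFB : kernelGroup n k ⊔ nielsenGroup n k = autFB n k := by
  refine le_antisymm sup_le_autFB fun f hf => ?_
  obtain ⟨code, hcode_inj, hcode⟩ := exists_lexicographic_code ((Fin n ⊕ Fin k) × Bool)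
  obtain ⟨e, he, hmin⟩ := exists_locallyMinimal code f
  have hfe : f * e ∈ autFB n k := mul_mem hf (sup_le_autFB he)
  have hred := hmin.nielsenReduced hcode hcode_inj (f * e).injective
    (exists_isReducedConj_of_mem_autFB hfe)
  have hinv : (f * e)⁻¹ ∈ signedPerms n k := by
    refine mem_signedPerms_of_norm_eq_one (inv_mem hfe) fun z => ?_
    have h1 := hred.norm_le ((f * e)⁻¹ (of z))
    have h2 : (f * e).toMonoidHom ((f * e)⁻¹ (of z)) = of z := MulAut.apply_inv_self _ (f * e) _
    rw [h2, norm_of] at h1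
    have h3 : ((f * e)⁻¹ (of z)).norm ≠ 0 := by
      rw [Ne, FreeGroup.norm_eq_zero, map_eq_one_iff _ (f * e)⁻¹.injective]
      exact of_ne_one z
    omega
  have hG : f * e ∈ kernelGroup n k ⊔ nielsenGroup n k := by
    rw [← inv_mem_iff]
    exact (le_sup_right : nielsenGroup n k ≤ _) (Subgroup.subset_closure (Or.inl hinv))
  simpa using mul_mem hG (inv_mem he)

end Generation

/-! ### Generators of the Birman kernel -/

section Kernel

open FreeGroup hiding map_inv map_mul map_one

variable {n k : ℕ}

theorem mem_birmanKernel_iff {f : MulAut (F n k)} :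
    f ∈ birmanKernel n k ↔ f ∈ autFB n k ∧ ∀ i, proj n k (f (of (Sum.inl i))) = of i := by
  constructor
  · rintro ⟨g, hg, rfl⟩
    refine ⟨g.2, fun i => ?_⟩
    have h1 := birmanMap_proj g (of (Sum.inl i))
    rw [MonoidHom.mem_ker.1 hg] at h1
    change _ = proj n k (g.1 _) at h1
    exact h1.symm.trans (by simp [proj])
  · rintro ⟨hf, h⟩
    refine ⟨⟨f, hf⟩, ?_, rfl⟩
    rw [SetLike.mem_coe, MonoidHom.mem_ker]
    refine mulAut_ext fun i => ?_
    have h1 := birmanMap_proj ⟨f, hf⟩ (of (Sum.inl i))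
    have h2 : proj n k (of (Sum.inl i)) = of i := by simp [proj]
    rw [h2] at h1
    rw [h1, h]
    rfl

/-- The automorphisms that fix every `y_j` and preserve the subgroup generated by the `x_i`. The
second condition is expressed by commutation with the retraction onto that subgroup. -/
def extensionGroup (n k : ℕ) : Subgroup (MulAut (F n k)) where
  carrier := {g | (∀ j, g (y j) = y j) ∧
    ∀ w, g (incl n k (proj n k w)) = incl n k (proj n k (g w))}
  one_mem' := ⟨fun _ => rfl, fun _ => rfl⟩
  mul_mem' := by
    rintro f g ⟨hf, hf'⟩ ⟨hg, hg'⟩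
    refine ⟨fun j => ?_, fun w => ?_⟩
    · rw [MulAut.mul_apply, hg, hf]
    · rw [MulAut.mul_apply, MulAut.mul_apply, hg', hf']
  inv_mem' := by
    rintro f ⟨hf, hf'⟩
    refine ⟨fun j => ?_, fun w => ?_⟩
    · nth_rewrite 1 [← hf j]
      exact MulAut.inv_apply_self _ f _
    · apply f.injective
      rw [hf', MulAut.apply_inv_self, MulAut.apply_inv_self]

theorem mem_extensionGroup {g : MulAut (F n k)} (hy : ∀ j, g (y j) = y j)
    (hx : ∀ i, incl n k (proj n k (g (of (Sum.inl i)))) = g (of (Sum.inl i))) :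
    g ∈ extensionGroup n k := by
  refine ⟨hy, fun w => ?_⟩
  have : (g.toMonoidHom.comp (incl n k)).comp (proj n k) =
      ((incl n k).comp (proj n k)).comp g.toMonoidHom := by
    ext s
    rcases s with i | j
    · change g (incl n k (proj n k (of (Sum.inl i)))) = incl n k (proj n k (g (of (Sum.inl i))))
      rw [hx]
      simp [proj, incl, x]
    · change g (incl n k (proj n k (y j))) = incl n k (proj n k (g (y j)))
      rw [hy]
      simp [proj, y]
  exact DFunLike.congr_fun this w

theorem nielsenGroup_le_extensionGroup : nielsenGroup n k ≤ extensionGroup n k := by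
  refine (Subgroup.closure_le _).2 ?_
  have hmk : ∀ (i : Fin n) (e : Bool), incl n k (proj n k (mk [(Sum.inl i, e)])) =
      mk [(Sum.inl i, e)] := by
    intro i e
    cases e
    · have : (mk [(Sum.inl i, false)] : F n k) = (of (Sum.inl i))⁻¹ := rfl
      rw [this]
      simp [proj, incl, x]
    · change incl n k (proj n k (of (Sum.inl i))) = of (Sum.inl i)
      simp [proj, incl, x]
  rintro g (⟨σ, ε, h1, h2⟩ | ⟨a, b, hab, rfl⟩)
  · refine mem_extensionGroup (fun j => ?_) fun i => ?_
    · rw [y, h1, (h2 j).1, (h2 j).2, of]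
    · rw [h1]
      rcases h : σ (Sum.inl i) with i' | j
      · exact hmk _ _
      · rw [← (h2 j).1] at h
        simpa using σ.injective h
  · refine mem_extensionGroup (fun j => mv_of_ne _ _ Sum.inr_ne_inl) fun i => ?_
    by_cases hi : i = a
    · subst hi
      rw [mv_of_self, mul_one, map_mul, map_mul]
      exact congrArg₂ _ (hmk b true) (hmk i true)
    · rw [mv_of_ne _ _ (by simpa using hi)]
      exact hmk i true

theorem kernelGroup_le_birmanKernel : kernelGroup n k ≤ birmanKernel n k := by
  refine (Subgroup.closure_le _).2 fun f hf => mem_birmanKernel_iff.2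
    ⟨kernelMoves_subset_autFB hf, fun i => ?_⟩
  have h1 : proj n k (of (Sum.inl i)) = of i := by simp [proj]
  rcases hf with ⟨i', j, rfl⟩ | ⟨i', j, rfl⟩ | ⟨j, z, hz, rfl⟩
  · by_cases hi : i = i'
    · subst hi
      rw [mv_of_self]
      simp [proj]
    · rw [mv_of_ne _ _ (by simpa using hi), h1]
  · by_cases hi : i = i'
    · subst hi
      rw [mv_of_self]
      simp [proj]
    · rw [mv_of_ne _ _ (by simpa using hi), h1]
  · change proj n k (cmv (Sum.inr j) (of z) (of_mem_rest hz) (of (Sum.inl i))) = _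
    rw [mv_of_ne _ _ Sum.inl_ne_inr, h1]

/-- The Birman kernel is generated by the kernel moves. -/
theorem birmanKernel_eq : birmanKernel n k = kernelGroup n k := by
  refine le_antisymm (fun f hf => ?_) kernelGroup_le_birmanKernel
  have h1 := (mem_birmanKernel_iff.1 hf).1
  rw [← sup_eq_autFB] at h1
  obtain ⟨ν, hν, γ, hγ, rfl⟩ := exists_mul_of_mem_sup h1
  have h2 : γ ∈ birmanKernel n k := by
    simpa using mul_mem (inv_mem (kernelGroup_le_birmanKernel hν)) hf
  obtain ⟨h3, h4⟩ := nielsenGroup_le_extensionGroup hγ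
  have h5 : γ = 1 := by
    refine mulAut_ext fun s => ?_
    rcases s with i | j
    · have h6 := h4 (of (Sum.inl i))
      rw [(mem_birmanKernel_iff.1 h2).2 i] at h6
      have h7 : incl n k (of i) = of (Sum.inl i) := by simp [incl, x]
      have h8 : proj n k (of (Sum.inl i)) = of i := by simp [proj]
      rw [h8, h7] at h6
      exact h6
    · exact h3 j
  rwa [h5, mul_one]

end Kernel

/-! ### The subgroup generated by conjugation moves and commutator transvections -/

section Torelli

open FreeGroup hiding map_inv map_mul map_one
open scoped commutatorElement

variable {n k : ℕ}

/-- The subgroup generated by the moves `M_{x,[y,z]}`, `C_{y,z}` and `C_{z,y}`. -/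
def torelliGroup (n k : ℕ) : Subgroup (MulAut (F n k)) :=
  Subgroup.closure (commTransvections n k ∪ conjMoves n k)

theorem cmv_inr_mem_torelliGroup {j : Fin k} {u : F n k} (hu : u ∈ rest (Sum.inr j)) :
    cmv (Sum.inr j) u hu ∈ torelliGroup n k :=
  cmv_mem (fun z hz => Subgroup.subset_closure (Or.inr ⟨j, z, hz, Or.inl rfl⟩)) hu

/-- The basis element `y_j` or its inverse. -/
def IsLetterY (j : Fin k) (β : F n k) : Prop := β = of (Sum.inr j) ∨ β = (of (Sum.inr j))⁻¹

theorem IsLetterY.inv {j : Fin k} {β : F n k} (h : IsLetterY j β) : IsLetterY j β⁻¹ := by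
  rcases h with rfl | rfl
  · exact Or.inr rfl
  · exact Or.inl (inv_inv _)

theorem IsLetterY.mem_rest {j : Fin k} {β : F n k} (h : IsLetterY j β) {z : Fin n ⊕ Fin k}
    (hz : Sum.inr j ≠ z) : β ∈ rest z := by
  rcases h with rfl | rfl
  · exact of_mem_rest hz
  · exact inv_mem (of_mem_rest hz)

theorem IsLetterY.map_eq {j : Fin k} {β : F n k} (h : IsLetterY j β) {f : MulAut (F n k)}
    (hf : f (of (Sum.inr j)) = of (Sum.inr j)) : f β = β := by
  rcases h with rfl | rfl
  · exact hf
  · rw [map_inv, hf]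

theorem cmv_inl_mem_torelliGroup {i : Fin n} {j : Fin k} {β : F n k} (hβ : IsLetterY j β) :
    cmv (Sum.inl i) β (hβ.mem_rest Sum.inr_ne_inl) ∈ torelliGroup n k := by
  have h : cmv (Sum.inl i) (of (Sum.inr j)) (inr_mem_rest_inl i j) ∈ torelliGroup n k :=
    Subgroup.subset_closure (Or.inr ⟨j, Sum.inl i, Sum.inl_ne_inr, Or.inr rfl⟩)
  rcases hβ with rfl | rfl
  · exact h
  · have := inv_mem h
    rwa [mv_inv] at this

theorem conj_inv_mem_leftFactors {i : Fin n} {j : Fin k} {β : F n k} (hβ : IsLetterY j β)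
    {v : F n k} (hv : v ∈ leftFactors (torelliGroup n k) i) :
    β⁻¹ * v * β ∈ leftFactors (torelliGroup n k) i := by
  have hβr := hβ.mem_rest (z := (Sum.inl i : Fin n ⊕ Fin k)) Sum.inr_ne_inl
  obtain ⟨hv, hG⟩ := hv
  refine ⟨mul_mem (mul_mem (inv_mem hβr) hv) hβr, ?_⟩
  have h := mul_mem (mul_mem (cmv_inl_mem_torelliGroup (i := i) hβ) hG)
    (inv_mem (cmv_inl_mem_torelliGroup (i := i) hβ))
  rw [mv_inv, mv_mul, mv_mul] at h
  rwa [mv_congr _ _ (show β⁻¹ * (v * β) = β⁻¹ * v * β by group)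
    (show β⁻¹ * 1 * β⁻¹⁻¹ = 1 by group)] at h

theorem conj_mem_leftFactors_torelliGroup {i : Fin n} {j : Fin k} {β : F n k}
    (hβ : IsLetterY j β) {v : F n k} (hv : v ∈ leftFactors (torelliGroup n k) i) :
    β * v * β⁻¹ ∈ leftFactors (torelliGroup n k) i := by
  simpa using conj_inv_mem_leftFactors hβ.inv hv

theorem commutator_mem_leftFactors {i : Fin n} {j : Fin k} {β : F n k} (hβ : IsLetterY j β)
    {z : Fin n ⊕ Fin k} (hz : z ≠ Sum.inl i) :
    ⁅β, of z⁆ ∈ leftFactors (torelliGroup n k) i := by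
  by_cases hzj : z = Sum.inr j
  · subst hzj
    convert one_mem (leftFactors (torelliGroup n k) i) using 1
    rcases hβ with rfl | rfl <;> simp [commutatorElement_def]
  · have h : ⁅(of (Sum.inr j) : F n k), of z⁆ ∈ leftFactors (torelliGroup n k) i := by
      refine ⟨?_, Subgroup.subset_closure (Or.inl ⟨i, j, z, hz, hzj, rfl⟩)⟩
      rw [commutatorElement_def]
      have h1 := inr_mem_rest_inl i j
      have h2 := of_mem_rest hz
      exact mul_mem (mul_mem (mul_mem h1 h2) (inv_mem h1)) (inv_mem h2)
    rcases hβ with rfl | rfl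
    · exact h
    · convert conj_inv_mem_leftFactors (Or.inl rfl : IsLetterY j _) (inv_mem h) using 1
      simp only [commutatorElement_def]
      group

/-- The moves `x_a ↦ y_b^{±1} x_a` normalize the group generated by the conjugation moves and the
commutator transvections. -/
theorem conj_mem_torelliGroup {a : Fin n} {b : Fin k} {β : F n k} (hβ : IsLetterY b β)
    {t : MulAut (F n k)} (ht : t ∈ commTransvections n k ∪ conjMoves n k) :
    lmul a β (hβ.mem_rest Sum.inr_ne_inl) * t * (lmul a β (hβ.mem_rest Sum.inr_ne_inl))⁻¹ ∈
      torelliGroup n k := by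
  have hβa := hβ.mem_rest (z := (Sum.inl a : Fin n ⊕ Fin k)) Sum.inr_ne_inl
  have hA : ∀ j z (hz : z ≠ Sum.inr j),
      lmul a β hβa * cmv (Sum.inr j) (of z) (of_mem_rest hz) * (lmul a β hβa)⁻¹ ∈
        torelliGroup n k := by
    intro j z hz
    by_cases hza : z = Sum.inl a
    · subst hza
      by_cases hj : j = b
      · -- The move `y_b ↦ x_a y_b x_a⁻¹` becomes the conjugation of `x_a` by `β` after itself.
        subst hj
        convert mul_mem (cmv_inl_mem_torelliGroup (i := a) hβ)
          (cmv_inr_mem_torelliGroup (of_mem_rest hz)) using 1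
        refine conj_eq_of_forall fun s => ?_
        rw [MulAut.mul_apply]
        by_cases hs : s = Sum.inr j
        · subst hs
          rcases hβ with rfl | rfl <;> simp [mv_of_ne, mul_assoc]
        · by_cases hs' : s = Sum.inl a
          · subst hs'
            rcases hβ with rfl | rfl <;> simp [mv_of_ne, mul_assoc]
          · simp [mv_of_ne, hs, hs']
      · have hj' : (Sum.inr b : Fin n ⊕ Fin k) ≠ Sum.inr j := by simpa using Ne.symm hj
        convert cmv_inr_mem_torelliGroup (mul_mem (hβ.mem_rest hj') (of_mem_rest hz)) using 1
        refine conj_eq_of_forall fun s => ?_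
        by_cases hs : s = Sum.inr j
        · subst hs
          simp [mv_of_ne, mul_assoc]
        · by_cases hs' : s = Sum.inl a
          · subst hs'
            rw [mv_of_ne _ _ hs, mv_of_self, map_mul, map_mul, mv_of_ne _ _ hs, map_one,
              hβ.map_eq (mv_of_ne _ _ hj')]
          · simp [mv_of_ne, hs, hs']
    · by_cases hj : j = b
      · -- Conjugating `y_b` by `z` multiplies `x_a` by the commutator `β⁻¹ [β, z] β`.
        subst hj
        have hv : β⁻¹ * ⁅β, of z⁆ * β ∈ leftFactors (torelliGroup n k) a :=
          conj_inv_mem_leftFactors hβ (commutator_mem_leftFactors hβ hza)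
        obtain ⟨h1, h2⟩ := hv
        convert mul_mem h2 (cmv_inr_mem_torelliGroup (of_mem_rest hz)) using 1
        refine conj_eq_of_forall fun s => ?_
        rw [MulAut.mul_apply]
        by_cases hs : s = Sum.inr j
        · subst hs
          simp [mv_of_ne, hza]
        · by_cases hs' : s = Sum.inl a
          · subst hs'
            rcases hβ with rfl | rfl <;>
              simp [mv_of_ne, hza, commutatorElement_def, mul_assoc]
          · simp [mv_of_ne, hs, hs']
      · have hj' : (Sum.inr b : Fin n ⊕ Fin k) ≠ Sum.inr j := by simpa using Ne.symm hj
        convert cmv_inr_mem_torelliGroup (of_mem_rest hz) using 1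
        refine conj_eq_of_forall fun s => ?_
        by_cases hs : s = Sum.inr j
        · subst hs
          simp [mv_of_ne, hza]
        · by_cases hs' : s = Sum.inl a
          · subst hs'
            rw [mv_of_ne _ _ hs, mv_of_self, map_mul, map_mul, mv_of_ne _ _ hs, map_one,
              hβ.map_eq (mv_of_ne _ _ hj')]
          · simp [mv_of_ne, hs, hs']
  rcases ht with ⟨i, j, z, hzi, hzj, rfl⟩ | ⟨j, z, hz, rfl | rfl⟩
  · have hv := commutator_mem_leftFactors (i := i) (Or.inl rfl : IsLetterY j _) hzi
    have h0 := hv.1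
    change lmul a β hβa * lmul i ⁅of (Sum.inr j), of z⁆ h0 * (lmul a β hβa)⁻¹ ∈ _
    by_cases hi : i = a
    · subst hi
      obtain ⟨h1, h2⟩ := conj_inv_mem_leftFactors hβ hv
      convert h2 using 1
      rw [mv_inv, mv_mul, mv_mul]
      exact mv_congr _ _ (by group) (by group)
    · have hia : (Sum.inl a : Fin n ⊕ Fin k) ≠ Sum.inl i := by simpa using Ne.symm hi
      have hw : lmul a β hβa ⁅(of (Sum.inr j) : F n k), of z⁆ ∈ leftFactors (torelliGroup n k) i := by
        rw [map_commutatorElement, mv_of_ne _ _ Sum.inr_ne_inl]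
        by_cases hza : z = Sum.inl a
        · subst hza
          rw [mv_of_self, mul_one]
          -- `[y, β x_a] = [y, β] β [y, x_a] β⁻¹`
          have h1 := inv_mem (commutator_mem_leftFactors (i := i) hβ
            (Sum.inr_ne_inl : (Sum.inr j : Fin n ⊕ Fin k) ≠ Sum.inl i))
          have h2 := conj_mem_leftFactors_torelliGroup hβ
            (commutator_mem_leftFactors (i := i) (Or.inl rfl : IsLetterY j _) hia)
          convert mul_mem h1 h2 using 1
          simp only [commutatorElement_def]
          group
        · rwa [mv_of_ne _ _ hza]
      obtain ⟨h1, h2⟩ := hw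
      convert h2 using 1
      refine (conj_mv _ _ (mv_of_ne _ _ hia.symm) (fun s hs => ?_) h1
        (by rw [map_one]; exact one_mem _)).trans (mv_congr _ _ rfl (map_one _))
      by_cases hs' : s = Sum.inl a
      · subst hs'
        rw [mv_of_self]
        exact mul_mem (mul_mem (hβ.mem_rest Sum.inr_ne_inl) (of_mem_rest hs)) (one_mem _)
      · rw [mv_of_ne _ _ hs']
        exact of_mem_rest hs
  · exact hA j z hz
  · rcases z with i | j'
    · change lmul a β hβa * cmv (Sum.inl i) (of (Sum.inr j)) (inr_mem_rest_inl i j) *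
        (lmul a β hβa)⁻¹ ∈ _
      have hy : IsLetterY j (of (Sum.inr j) : F n k) := Or.inl rfl
      by_cases hi : i = a
      · subst hi
        obtain ⟨h1, h2⟩ := commutator_mem_leftFactors (i := i) hβ.inv
          (Sum.inr_ne_inl : (Sum.inr j : Fin n ⊕ Fin k) ≠ Sum.inl i)
        convert mul_mem (cmv_inl_mem_torelliGroup hy) h2 using 1
        rw [mv_inv, mv_mul, mv_mul, mv_mul]
        exact mv_congr _ _ (by simp only [commutatorElement_def]; group) (by group)
      · have hia : (Sum.inl a : Fin n ⊕ Fin k) ≠ Sum.inl i := by simpa using Ne.symm hi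
        convert cmv_inl_mem_torelliGroup (i := i) hy using 1
        refine (conj_mv _ _ (mv_of_ne _ _ hia.symm) (fun s hs => ?_)
          (by rw [mv_of_ne _ _ Sum.inr_ne_inl]; exact inr_mem_rest_inl i j)
          (by rw [map_inv, mv_of_ne _ _ Sum.inr_ne_inl]; exact inv_mem (inr_mem_rest_inl i j))).trans
          (mv_congr _ _ (mv_of_ne _ _ Sum.inr_ne_inl)
            (by rw [map_inv, mv_of_ne _ _ Sum.inr_ne_inl]))
        by_cases hs' : s = Sum.inl a
        · subst hs'
          rw [mv_of_self]
          exact mul_mem (mul_mem (hβ.mem_rest Sum.inr_ne_inl) (of_mem_rest hs)) (one_mem _)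
        · rw [mv_of_ne _ _ hs']
          exact of_mem_rest hs
    · exact hA j' (Sum.inr j) hz.symm

/-- The subgroup generated by the transvections `x_i ↦ y_j x_i`. -/
def transvectionGroup (n k : ℕ) : Subgroup (MulAut (F n k)) :=
  Subgroup.closure {f | ∃ i j, f = lmul i (of (Sum.inr j)) (inr_mem_rest_inl i j)}

theorem transvectionGroup_le_normalizer :
    transvectionGroup n k ≤ Subgroup.normalizer (torelliGroup n k : Set (MulAut (F n k))) := by
  refine (Subgroup.closure_le _).2 ?_
  rintro _ ⟨i, j, rfl⟩
  refine mem_normalizer_closure (fun t ht => conj_mem_torelliGroup (Or.inl rfl) ht)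
    fun t ht => ?_
  have h := conj_mem_torelliGroup (a := i) (Or.inr rfl : IsLetterY j _) ht
  have e : (lmul i (of (Sum.inr j)) (inr_mem_rest_inl i j))⁻¹ =
      lmul i (of (Sum.inr j))⁻¹ (inv_mem (inr_mem_rest_inl i j)) := by
    rw [mv_inv, mv_congr _ _ rfl inv_one]
  rw [← e, inv_inv] at h
  exact h

/-- The right multiplication `x_i ↦ x_i y_j` differs from a left multiplication by a conjugation
move. -/
theorem kernelGroup_le_sup : kernelGroup n k ≤ torelliGroup n k ⊔ transvectionGroup n k := by
  have hl : ∀ i j, lmul i (of (Sum.inr j)) (inr_mem_rest_inl i j) ∈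
      torelliGroup n k ⊔ transvectionGroup n k := fun i j =>
    (le_sup_right : transvectionGroup n k ≤ _) (Subgroup.subset_closure ⟨i, j, rfl⟩)
  refine (Subgroup.closure_le _).2 ?_
  rintro _ (⟨i, j, rfl⟩ | ⟨i, j, rfl⟩ | ⟨j, z, hz, rfl⟩)
  · exact hl i j
  · have h := cmv_inl_mem_torelliGroup (i := i) (Or.inr rfl : IsLetterY j _)
    have h2 := mul_mem ((le_sup_left : torelliGroup n k ≤ _ ⊔ transvectionGroup n k) h) (hl i j)
    rwa [mv_mul, mv_congr _ _ (mul_inv_cancel (of (Sum.inr j) : F n k))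
      (show (of (Sum.inr j) : F n k)⁻¹⁻¹ * 1 = of (Sum.inr j) by group)] at h2
  · exact (le_sup_left : torelliGroup n k ≤ _)
      (Subgroup.subset_closure (Or.inr ⟨j, z, hz, Or.inl rfl⟩))

theorem exists_mul_of_mem_kernelGroup {f : MulAut (F n k)} (hf : f ∈ kernelGroup n k) :
    ∃ h ∈ torelliGroup n k, ∃ p ∈ transvectionGroup n k, f = h * p := by
  have hf := kernelGroup_le_sup hf
  rw [sup_comm, ← SetLike.mem_coe,
    Subgroup.coe_mul_of_left_le_normalizer_right _ _ transvectionGroup_le_normalizer,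
    Subgroup.set_mul_normalizer_comm _ _ transvectionGroup_le_normalizer] at hf
  obtain ⟨h, hh, p, hp, rfl⟩ := hf
  exact ⟨h, hh, p, hp, rfl⟩

end Torelli

/-! ### Simultaneous transvections by words in the `y_j` -/

section MultiTransvection

open FreeGroup hiding map_inv map_mul map_one
open scoped commutatorElement

variable {n k : ℕ}

/-- The endomorphism `x_i ↦ v_i⁻¹ x_i` for words `v_i` in the `y_j`. -/
def multiHom (v : Fin n → FreeGroup (Fin k)) : F n k →* F n k :=
  lift (Sum.elim (fun i => (FreeGroup.map Sum.inr (v i))⁻¹ * of (Sum.inl i))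
    fun j => of (Sum.inr j))

theorem multiHom_map_inr (v : Fin n → FreeGroup (Fin k)) (w : FreeGroup (Fin k)) :
    multiHom v (FreeGroup.map Sum.inr w) = FreeGroup.map Sum.inr w := by
  have : (multiHom v).comp (FreeGroup.map Sum.inr) = FreeGroup.map Sum.inr := by
    ext j
    simp [multiHom]
  exact DFunLike.congr_fun this w

theorem multiHom_multiHom (v w : Fin n → FreeGroup (Fin k)) (g : F n k) :
    multiHom v (multiHom w g) = multiHom (v * w) g := by
  have : (multiHom v).comp (multiHom w) = multiHom (v * w) := by
    ext s
    rcases s with i | j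
    · have h1 : ∀ u : Fin n → FreeGroup (Fin k), multiHom u (of (Sum.inl i)) =
          (FreeGroup.map Sum.inr (u i))⁻¹ * of (Sum.inl i) := fun u => by simp [multiHom]
      rw [MonoidHom.comp_apply, h1, map_mul, map_inv, multiHom_map_inr, h1, h1, Pi.mul_apply,
        map_mul, mul_inv_rev, mul_assoc]
    · simp [multiHom]
  exact DFunLike.congr_fun this g

theorem multiHom_one (g : F n k) : multiHom 1 g = g := by
  have : multiHom (1 : Fin n → FreeGroup (Fin k)) = MonoidHom.id (F n k) := by
    ext s
    rcases s with i | j <;> simp [multiHom]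
  exact DFunLike.congr_fun this g

/-- The automorphism `x_i ↦ v_i⁻¹ x_i` for words `v_i` in the `y_j`. The inverse makes this a
homomorphism in `v`. -/
def multiTransvection (n k : ℕ) : (Fin n → FreeGroup (Fin k)) →* MulAut (F n k) where
  toFun v :=
    { toFun := multiHom v
      invFun := multiHom v⁻¹
      left_inv := fun g => by rw [multiHom_multiHom, inv_mul_cancel, multiHom_one]
      right_inv := fun g => by rw [multiHom_multiHom, mul_inv_cancel, multiHom_one]
      map_mul' := map_mul _ }
  map_one' := by
    ext1 g
    exact multiHom_one g
  map_mul' v w := by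
    ext1 g
    exact (multiHom_multiHom v w g).symm

theorem multiTransvection_inl (v : Fin n → FreeGroup (Fin k)) (i : Fin n) :
    multiTransvection n k v (of (Sum.inl i)) =
      (FreeGroup.map Sum.inr (v i))⁻¹ * of (Sum.inl i) := by
  change multiHom v (of (Sum.inl i)) = _
  simp [multiHom]

theorem multiTransvection_inr (v : Fin n → FreeGroup (Fin k)) (j : Fin k) :
    multiTransvection n k v (of (Sum.inr j)) = of (Sum.inr j) := by
  change multiHom v (of (Sum.inr j)) = _
  simp [multiHom]

theorem multiTransvection_mulSingle (i : Fin n) (u : FreeGroup (Fin k))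
    (hu : (FreeGroup.map Sum.inr u)⁻¹ ∈ rest (Sum.inl i)) :
    multiTransvection n k (Pi.mulSingle i u) = lmul i (FreeGroup.map Sum.inr u)⁻¹ hu := by
  refine mulAut_ext fun s => ?_
  rcases s with i' | j
  · rw [multiTransvection_inl]
    by_cases h : i' = i
    · subst h
      simp
    · rw [mv_of_ne _ _ (by simpa using h), Pi.mulSingle_eq_of_ne h]
      simp
  · rw [multiTransvection_inr, mv_of_ne _ _ Sum.inr_ne_inl]

theorem transvectionGroup_le_range : transvectionGroup n k ≤ (multiTransvection n k).range := by
  refine (Subgroup.closure_le _).2 ?_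
  rintro _ ⟨i, j, rfl⟩
  have h : (FreeGroup.map Sum.inr (of j)⁻¹)⁻¹ = (of (Sum.inr j) : F n k) := by simp [of, invRev]
  refine ⟨Pi.mulSingle i (of j)⁻¹, ?_⟩
  rw [multiTransvection_mulSingle i _ (h ▸ inr_mem_rest_inl i j)]
  exact mv_congr _ _ h rfl

theorem mem_torelli_iff {f : MulAut (F n k)} :
    f ∈ torelli n k ↔
      ∀ s, Abelianization.of (f (of s)) = Abelianization.of (of s : F n k) := by
  constructor
  · intro h s
    exact DFunLike.congr_fun (MonoidHom.mem_ker.1 h) (Abelianization.of (of s))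
  · intro h
    have : Abelianization.of.comp f.toMonoidHom = (Abelianization.of : F n k →* _) := ext_hom _ _ h
    refine MonoidHom.mem_ker.2 ?_
    ext a
    induction a using QuotientGroup.induction_on with
    | H g => exact DFunLike.congr_fun this g

/-- The words `u` in the `y_j` for which `x_i ↦ u x_i` lies in the group generated by the given
moves form a normal subgroup with commutative quotient. -/
theorem commutator_le_comap_leftFactors (i : Fin n) :
    commutator (FreeGroup (Fin k)) ≤
      (leftFactors (torelliGroup n k) i).comap (FreeGroup.map Sum.inr) := by
  have hof : ∀ j, (FreeGroup.map Sum.inr (of j) : F n k) = of (Sum.inr j) := fun j => by simp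
  have hnormal : ((leftFactors (torelliGroup n k) i).comap (FreeGroup.map Sum.inr)).Normal := by
    refine ⟨fun v hv u => ?_⟩
    induction u using FreeGroup.induction_on generalizing v with
    | C1 => simpa using hv
    | of j =>
      rw [Subgroup.mem_comap] at hv ⊢
      rw [map_mul, map_mul, map_inv, hof]
      exact conj_mem_leftFactors_torelliGroup (Or.inl rfl) hv
    | inv_of j _ =>
      rw [Subgroup.mem_comap] at hv ⊢
      rw [map_mul, map_mul, map_inv, map_inv, hof]
      exact conj_mem_leftFactors_torelliGroup (Or.inr rfl) hv
    | mul u u' hu hu' =>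
      have := hu _ (hu' v hv)
      simpa only [mul_inv_rev, mul_assoc] using this
  generalize hB : (leftFactors (torelliGroup n k) i).comap (FreeGroup.map Sum.inr) = B
    at hnormal ⊢
  have hgen : ∀ j j', Commute (QuotientGroup.mk (of j) : FreeGroup (Fin k) ⧸ B) (QuotientGroup.mk (of j')) := by
    intro j j'
    rw [← commutatorElement_eq_one_iff_commute]
    have h : ⁅of j, of j'⁆ ∈ B := by
      rw [← hB, Subgroup.mem_comap, map_commutatorElement, hof, hof]
      exact commutator_mem_leftFactors (Or.inl rfl) Sum.inr_ne_inl
    exact (QuotientGroup.eq_one_iff _).2 h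
  have hcomm : ∀ u v : FreeGroup (Fin k), Commute (QuotientGroup.mk u : FreeGroup (Fin k) ⧸ B) (QuotientGroup.mk v) := by
    intro u v
    induction u using FreeGroup.induction_on with
    | C1 => exact Commute.one_left _
    | of j =>
      induction v using FreeGroup.induction_on with
      | C1 => exact Commute.one_right _
      | of j' => exact hgen j j'
      | inv_of j' h => exact h.inv_right
      | mul v v' h h' => exact h.mul_right h'
    | inv_of j h => exact h.inv_left
    | mul u u' h h' => exact h.mul_left h'
  rw [commutator_def, Subgroup.commutator_le]
  intro u _ v _
  rw [← QuotientGroup.eq_one_iff]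
  exact commutatorElement_eq_one_iff_commute.2 (hcomm u v)

/-- A simultaneous transvection acting trivially on the abelianization is a product of
transvections `x_i ↦ v_i⁻¹ x_i`, where `v_i` lies in the commutator subgroup. -/
theorem multiTransvection_mem_torelliGroup {v : Fin n → FreeGroup (Fin k)}
    (hv : multiTransvection n k v ∈ torelli n k) :
    multiTransvection n k v ∈ torelliGroup n k := by
  have h1 : ∀ i, v i ∈ commutator (FreeGroup (Fin k)) := by
    intro i
    have h2 := mem_torelli_iff.1 hv (Sum.inl i)
    rw [multiTransvection_inl, map_mul, mul_eq_right, map_inv, inv_eq_one] at h2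
    -- The retraction of `F_{n,k}` onto the free group on the `y_j`.
    let ρ : F n k →* FreeGroup (Fin k) := lift (Sum.elim (fun _ => 1) of)
    have h3 : ρ (FreeGroup.map Sum.inr (v i)) = v i := by
      have : ρ.comp (FreeGroup.map Sum.inr) = MonoidHom.id _ := by
        ext j
        simp [ρ]
      exact DFunLike.congr_fun this (v i)
    have h4 := congrArg (Abelianization.map ρ) h2
    rw [Abelianization.map_of, h3, map_one] at h4
    exact (QuotientGroup.eq_one_iff _).1 h4
  change v ∈ (torelliGroup n k).comap (multiTransvection n k)
  refine Subgroup.pi_mem_of_mulSingle_mem v fun i => ?_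
  obtain ⟨h2, h3⟩ := inv_mem (Subgroup.mem_comap.1 (commutator_le_comap_leftFactors i (h1 i)))
  rw [Subgroup.mem_comap, multiTransvection_mulSingle i _ h2]
  exact h3

theorem torelliGroup_le : torelliGroup n k ≤ torelliBirmanKernel n k := by
  have hcomm : ∀ a b : Abelianization (F n k), a * b * a⁻¹ = b := fun a b => by
    rw [mul_comm a, mul_inv_cancel_right]
  have hC : ∀ z z' (h : z' ≠ z), conjMove z z' h ∈ torelli n k := by
    intro z z' h
    refine mem_torelli_iff.2 fun s => ?_
    change Abelianization.of (cmv z (of z') (of_mem_rest h) (of s)) = _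
    by_cases hs : s = z
    · subst hs
      rw [mv_of_self, map_mul, map_mul, map_inv, hcomm]
    · rw [mv_of_ne _ _ hs]
  refine (Subgroup.closure_le _).2 ?_
  rintro f (⟨i, j, z, hzi, hzj, rfl⟩ | ⟨j, z, hz, rfl | rfl⟩)
  · have h0 : ⁅(of (Sum.inr j) : F n k), of z⁆ ∈ rest (Sum.inl i) :=
      (commutator_mem_leftFactors (Or.inl rfl : IsLetterY j _) hzi).1
    have hself : commTransvection (Sum.inl i) (Sum.inr j) z Sum.inr_ne_inl hzi (of (Sum.inl i)) =
        ⁅(of (Sum.inr j) : F n k), of z⁆ * of (Sum.inl i) :=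
      (mv_of_self h0 (one_mem _)).trans (mul_one _)
    have hne : ∀ s, s ≠ Sum.inl i →
        commTransvection (Sum.inl i) (Sum.inr j) z Sum.inr_ne_inl hzi (of s) = of s :=
      fun s hs => mv_of_ne h0 (one_mem _) hs
    refine ⟨mem_birmanKernel_iff.2 ⟨fun j' => ?_, fun i' => ?_⟩, mem_torelli_iff.2 fun s => ?_⟩
    · rw [y, hne _ Sum.inr_ne_inl]
    · by_cases h : i' = i
      · subst h
        rw [hself]
        simp [proj, commutatorElement_def]
      · rw [hne _ (by simpa using h)]
        simp [proj]
    · by_cases hs : s = Sum.inl i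
      · subst hs
        rw [hself, map_mul, map_commutatorElement, commutatorElement_def, hcomm]
        simp
      · rw [hne s hs]
  · refine ⟨kernelGroup_le_birmanKernel (conjMove_mem_kernelGroup j z hz), hC _ _ _⟩
  · refine ⟨?_, hC _ _ _⟩
    rcases z with i | j'
    · refine mem_birmanKernel_iff.2 ⟨fun j' => ?_, fun i' => ?_⟩
      · change IsConj (cmv (Sum.inl i) (of (Sum.inr j)) (inr_mem_rest_inl i j)
          (of (Sum.inr j'))) _
        rw [mv_of_ne _ _ Sum.inr_ne_inl]
        exact IsConj.refl _
      · change proj n k (cmv (Sum.inl i) (of (Sum.inr j)) (inr_mem_rest_inl i j)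
          (of (Sum.inl i'))) = _
        by_cases h : i' = i
        · subst h
          rw [mv_of_self]
          simp [proj]
        · rw [mv_of_ne _ _ (by simpa using h)]
          simp [proj]
    · exact kernelGroup_le_birmanKernel (conjMove_mem_kernelGroup j' _ hz.symm)

/-- The Torelli Birman kernel is generated by the given moves. -/
theorem torelliGroup_eq : torelliGroup n k = torelliBirmanKernel n k := by
  refine le_antisymm torelliGroup_le ?_
  rintro f ⟨hK, hI⟩
  rw [SetLike.mem_coe, birmanKernel_eq] at hK
  obtain ⟨h, hh, p, hp, rfl⟩ := exists_mul_of_mem_kernelGroup hK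
  obtain ⟨v, rfl⟩ := transvectionGroup_le_range hp
  have hv : multiTransvection n k v ∈ torelli n k := by
    have h1 : h ∈ torelli n k := (torelliGroup_le hh).2
    simpa using mul_mem (inv_mem h1) hI
  exact mul_mem hh (multiTransvection_mem_torelliGroup hv)

theorem finite_generators (n k : ℕ) : (commTransvections n k ∪ conjMoves n k).Finite := by
  refine Set.Finite.union ?_ ?_
  · refine (Set.finite_range fun q : {q : Fin n × Fin k × (Fin n ⊕ Fin k) // q.2.2 ≠ Sum.inl q.1} =>
      commTransvection (Sum.inl q.1.1) (Sum.inr q.1.2.1) q.1.2.2 Sum.inr_ne_inl q.2).subset ?_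
    rintro f ⟨i, j, z, hzi, hzj, rfl⟩
    exact ⟨⟨(i, j, z), hzi⟩, rfl⟩
  · refine (Set.finite_range fun q : {q : (Fin n ⊕ Fin k) × (Fin n ⊕ Fin k) // q.2 ≠ q.1} =>
      conjMove q.1.1 q.1.2 q.2).subset ?_
    rintro f ⟨j, z, hz, rfl | rfl⟩
    · exact ⟨⟨(Sum.inr j, z), hz⟩, rfl⟩
    · exact ⟨⟨(z, Sum.inr j), hz.symm⟩, rfl⟩

end MultiTransvection

end TorelliBirman

theorem theoremA (n k : ℕ) :
    (TorelliBirman.commTransvections n k ∪ TorelliBirman.conjMoves n k).Finite ∧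
      Subgroup.closure (TorelliBirman.commTransvections n k ∪ TorelliBirman.conjMoves n k) =
        TorelliBirman.torelliBirmanKernel n k :=
  ⟨TorelliBirman.finite_generators n k, TorelliBirman.torelliGroup_eq⟩
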